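/- Let $d\ge 1$ and let $U$ be a unitary $d\times d$ matrix with columns $|u_i\rangle=U|i\rangle$. Let $\mathcal P_U(\rho)=\sum_{i=1}^d\langle u_i|\rho|u_i\rangle\,|i\rangle\langle i|$ be the measure-and-prepare channel of the von Neumann measurement in the basis $(u_i)$, and let $\mathcal P_{1}$ be that of the computational basis. For a linear map $\Phi$ from $d\times d$ matrices to $n\times n$ matrices let $\|\Phi\|_\diamond=\max_{\|X\|_1=1}\|(\Phi\otimes 1_d)(X)\|_1$, where $\|\cdot\|_1$ is the trace norm. Let $\Omega_d$ be the set of $d\times d$ density matrices and $\mathcal{DU}_d$ the set of diagonal unitary $d\times d$ matrices. Put $$\nu=\min_{\rho\in\Omega_d}\|\mathrm{diag}(U^\dagger\rho)\|_1=\min_{\rho\in\Omega_d}\sum_{i=1}^d|(U^\dagger\rho)_{ii}| .$$ Then $$\nu=\min_{\rho\in\Omega_d}\sum_{i=1}^d|\langle i|\rho U|i\rangle|=\max_{E\in\mathcal{DU}_d}\ \min_{\rho\in\Omega_d}|\mathrm{Tr}\,\rho UE|,$$ all these minima and maxima being attained, and $$\|\mathcal P_U-\mathcal P_{1}\|_\diamond=2\sqrt{1-\nu^2}.$$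 Call a unit vector $\psi\in\mathbb C^d\otimes\mathbb C^k$ an optimal input state if $\|((\mathcal P_U-\mathcal P_1)\otimes 1_k)(|\psi\rangle\langle\psi|)\|_1=\|\mathcal P_U-\mathcal P_1\|_\diamond$, and a purification of $\rho$ if the partial trace of $|\psi\rangle\langle\psi|$ over $\mathbb C^k$ is $\rho$. Some $\rho\in\Omega_d$ that attains the minimum $\nu$ of $\|\mathrm{diag}(U^\dagger\rho)\|_1$ has the property that all its purifications are optimal input states; it has a purification in $\mathbb C^d\otimes\mathbb C^k$ if and only if $k\ge\operatorname{rank}\rho$. Conversely, every optimal input state, with an ancilla of any dimension $k$, is a purification of a $\rho\in\Omega_d$ that attains the minimum $\nu$. -/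

import Mathlib

open scoped Matrix ComplexOrder

noncomputable section

namespace DiamondMeas

/-- The trace norm (sum of the singular values): `‖X‖₁ = Tr √(X† X)`. -/
def traceNorm {ι : Type*} [Fintype ι] [DecidableEq ι] (X : Matrix ι ι ℂ) : ℝ :=
  ∑ i, √((Matrix.isHermitian_conjTranspose_mul_self X).eigenvalues i)

/-- The taxicab norm of a complex vector. -/
def l1Norm {d : ℕ} (v : Fin d → ℂ) : ℝ := ∑ i, ‖v i‖

/-- The density matrices (quantum states) of dimension `d`. -/
def densityMatrices (d : ℕ) : Set (Matrix (Fin d) (Fin d) ℂ) :=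
  {ρ | ρ.PosSemidef ∧ ρ.trace = 1}

/-- The diagonal unitary matrices of dimension `d`. -/
def diagUnitaries (d : ℕ) : Set (Matrix (Fin d) (Fin d) ℂ) :=
  {E | E ∈ Matrix.unitaryGroup (Fin d) ℂ ∧ E.IsDiag}

/-- `Φ ⊗ 1_k` for a linear map `Φ : M_m → M_n`; a matrix on `ℂᵐ ⊗ ℂᵏ` is indexed by pairs, and `Φ`
acts on the `m × m` matrix obtained by fixing the two ancilla indices. -/
def ampliation {m n : ℕ} (Φ : Matrix (Fin m) (Fin m) ℂ →ₗ[ℂ] Matrix (Fin n) (Fin n) ℂ) (k : ℕ)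
    (X : Matrix (Fin m × Fin k) (Fin m × Fin k) ℂ) :
    Matrix (Fin n × Fin k) (Fin n × Fin k) ℂ :=
  Matrix.of fun p q => Φ (Matrix.of fun i j => X (i, p.2) (j, q.2)) p.1 q.1

/-- The values `‖(Φ ⊗ 1)(X)‖₁` with `‖X‖₁ = 1`, where the ancilla has the input dimension of `Φ`. -/
def diamondValues {m n : ℕ} (Φ : Matrix (Fin m) (Fin m) ℂ →ₗ[ℂ] Matrix (Fin n) (Fin n) ℂ) :
    Set ℝ :=
  (fun X : Matrix (Fin m × Fin m) (Fin m × Fin m) ℂ => traceNorm (ampliation Φ m X)) ''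
    {X | traceNorm X = 1}

/-- The diamond norm (completely bounded trace norm) of a linear map between matrix spaces. -/
def diamondNorm {m n : ℕ} (Φ : Matrix (Fin m) (Fin m) ℂ →ₗ[ℂ] Matrix (Fin n) (Fin n) ℂ) : ℝ :=
  sSup (diamondValues Φ)

/-- The measure-and-prepare channel `P_U(ρ) = ∑ᵢ ⟨uᵢ|ρ|uᵢ⟩ |i⟩⟨i|`, where `uᵢ` is the `i`-th
column of `U`. -/
def measurement {d : ℕ} (U : Matrix (Fin d) (Fin d) ℂ) :
    Matrix (Fin d) (Fin d) ℂ →ₗ[ℂ] Matrix (Fin d) (Fin d) ℂ where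
  toFun ρ := Matrix.diagonal fun i => star (U.col i) ⬝ᵥ (ρ *ᵥ U.col i)
  map_add' ρ σ := by
    rw [Matrix.diagonal_add]
    simp [Matrix.add_mulVec, dotProduct_add]
  map_smul' c ρ := by
    rw [← Matrix.diagonal_smul]
    congr 1
    funext i
    simp [Matrix.smul_mulVec, dotProduct_smul]

/-- The rank-one operator `|ψ⟩⟨ψ|` on `ℂᵈ ⊗ ℂᵏ`. -/
def pureState {d k : ℕ} (ψ : Fin d × Fin k → ℂ) :
    Matrix (Fin d × Fin k) (Fin d × Fin k) ℂ :=
  Matrix.vecMulVec ψ (star ψ)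

/-- `ψ ∈ ℂᵈ ⊗ ℂᵏ` is a purification of `ρ`: tracing the ancilla `ℂᵏ` out of `|ψ⟩⟨ψ|` leaves `ρ`. -/
def IsPurification {d k : ℕ} (ρ : Matrix (Fin d) (Fin d) ℂ) (ψ : Fin d × Fin k → ℂ) : Prop :=
  ∀ i j, ∑ a, pureState ψ (i, a) (j, a) = ρ i j

/-- `ψ ∈ ℂᵈ ⊗ ℂᵏ` is an optimal input state for discriminating the channels `Φ` and `Ψ` that act
on the first factor: it is a unit vector, and the trace distance of the two outputs is the diamond
norm of `Φ - Ψ`. -/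
def IsOptimalInput {d n k : ℕ}
    (Φ Ψ : Matrix (Fin d) (Fin d) ℂ →ₗ[ℂ] Matrix (Fin n) (Fin n) ℂ)
    (ψ : Fin d × Fin k → ℂ) : Prop :=
  star ψ ⬝ᵥ ψ = 1 ∧ traceNorm (ampliation (Φ - Ψ) k (pureState ψ)) = diamondNorm (Φ - Ψ)

end DiamondMeas

end

namespace DiamondMeas

open scoped Kronecker

/-! Multiplying `U` on the right by a diagonal unitary `E` does not change its measurement, so every
estimate may be made for `V = UE` with `E` chosen to suit.

Upper bound: write an input as `X = C Dᴴ` with balanced Hilbert-Schmidt norms. The measurement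
erases the off-diagonal blocks, and `blockExpand` turns the difference of the two outputs into `P
P'ᴴ - R R'ᴴ`, with `P`, `R` built from `C` and `P'`, `R'` from `D`. Polarization and Cauchy-Schwarz
bound its trace norm by the numbers `Re Tr Vᴴρ` for the reduced states `ρ` of `C` and `D`
(`traceNorm_ampliation_sub_le`); if both are at least `ν ≥ 0`, the bound is `2√(1 - ν²)`. For `ν >
0` a single `E` that works for all states exists by duality (`exists_dual_unitary`): Hahn-Banach
gives a diagonal contraction, and a spectral argument (`posSemidef_unitary_of_contraction`) lets its
moduli be raised to 1. For `ν = 0` the trivial bound 2 suffices.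

Attainment: for `0 < ν < 1`, complementary slackness puts a minimizer in the kernel of `V + Vᴴ -
2ν`, and averaging makes it commute with `V` while `(ρV)ᵢᵢ = ν ρᵢᵢ` (`exists_invariant_minimizer`).
For a purification of this `ρ` the two outputs then behave like two pure states of overlap `ν`
(`traceNorm_sub_ge_of_gram`).

Converse: for one fixed pure input, phases can be chosen so that `Tr ρUE` equals `μ = ∑ᵢ |(ρU)ᵢᵢ|`.
The output norm is then at most `2√(1 - μ²)`, so optimality forces `μ ≤ ν`. -/

/-- The squared Hilbert-Schmidt norm. -/
noncomputable def hsSq {m n : Type*} [Fintype m] [Fintype n] (A : Matrix m n ℂ) : ℝ :=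
  (Aᴴ * A).trace.re

/-! ### Hilbert-Schmidt geometry -/

section HilbertSchmidt

variable {m n : Type*} [Fintype m] [Fintype n]

theorem trace_conjTranspose_mul_eq_inner (A B : Matrix m n ℂ) :
    (Aᴴ * B).trace = inner ℂ (WithLp.toLp 2 fun p : n × m => A p.2 p.1)
      (WithLp.toLp 2 fun p : n × m => B p.2 p.1) := by
  simp [Matrix.trace, Matrix.mul_apply, PiLp.inner_apply, Fintype.sum_prod_type, mul_comm]

theorem hsSq_eq_norm_sq (A : Matrix m n ℂ) :
    hsSq A = ‖(WithLp.toLp 2 fun p : n × m => A p.2 p.1 : EuclideanSpace ℂ (n × m))‖ ^ 2 := by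
  rw [hsSq, trace_conjTranspose_mul_eq_inner, inner_self_eq_norm_sq_to_K]
  norm_cast

theorem hsSq_nonneg (A : Matrix m n ℂ) : 0 ≤ hsSq A := by
  rw [hsSq_eq_norm_sq]; positivity

theorem trace_conjTranspose_mul_self (A : Matrix m n ℂ) : (Aᴴ * A).trace = (hsSq A : ℂ) := by
  rw [hsSq_eq_norm_sq, trace_conjTranspose_mul_eq_inner, inner_self_eq_norm_sq_to_K]
  norm_cast

theorem hsSq_eq_zero {A : Matrix m n ℂ} (h : hsSq A = 0) : A = 0 := by
  rw [← Matrix.trace_conjTranspose_mul_self_eq_zero_iff, trace_conjTranspose_mul_self, h]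
  simp

theorem norm_trace_conjTranspose_mul_le (A B : Matrix m n ℂ) :
    ‖(Aᴴ * B).trace‖ ≤ √(hsSq A) * √(hsSq B) := by
  rw [trace_conjTranspose_mul_eq_inner, hsSq_eq_norm_sq, hsSq_eq_norm_sq,
    Real.sqrt_sq (norm_nonneg _), Real.sqrt_sq (norm_nonneg _)]
  exact norm_inner_le_norm _ _

theorem hsSq_eq_sum (A : Matrix m n ℂ) : hsSq A = ∑ i, ∑ j, ‖A i j‖ ^ 2 := by
  rw [hsSq_eq_norm_sq, EuclideanSpace.norm_sq_eq, Fintype.sum_prod_type, Finset.sum_comm]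

/-- A partial isometry is a contraction: Pythagoras for the splitting of `A` by the projection `Kᴴ
K`. -/
theorem hsSq_mul_le_of_isometry_mul {l : Type*} [Fintype l] (K : Matrix l m ℂ)
    (hK : K * Kᴴ * K = K) (A : Matrix m n ℂ) : hsSq (K * A) ≤ hsSq A := by
  classical
  have key : hsSq A = hsSq (K * A) + hsSq (A - Kᴴ * (K * A)) := by
    rw [hsSq, hsSq, hsSq, ← Complex.add_re, ← Matrix.trace_add]
    congr 2
    have h : K * (Kᴴ * (K * A)) = K * A := by
      rw [← Matrix.mul_assoc, ← Matrix.mul_assoc, hK]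
    simp only [Matrix.conjTranspose_sub, Matrix.conjTranspose_mul, Matrix.conjTranspose_conjTranspose,
      Matrix.sub_mul, Matrix.mul_sub, Matrix.mul_assoc, h]
    abel
  have := hsSq_nonneg (A - Kᴴ * (K * A))
  linarith

end HilbertSchmidt

/-! ### Trace norm: variational bounds and balanced factorization -/

section TraceNorm

variable {ι : Type*} [Fintype ι] [DecidableEq ι]

theorem traceNorm_nonneg (X : Matrix ι ι ℂ) : 0 ≤ traceNorm X :=
  Finset.sum_nonneg fun _ _ => Real.sqrt_nonneg _

/-- A unitary `W` such that the columns of `X * W` are orthogonal, with the singular values of `X`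
as their norms. -/
theorem exists_singularValues (X : Matrix ι ι ℂ) :
    ∃ (W : Matrix ι ι ℂ) (σ : ι → ℝ), W * Wᴴ = 1 ∧ Wᴴ * W = 1 ∧ (∀ i, 0 ≤ σ i) ∧
      traceNorm X = ∑ i, σ i ∧ Wᴴ * (Xᴴ * X) * W = Matrix.diagonal fun i => ((σ i ^ 2 : ℝ) : ℂ) := by
  have hX := Matrix.isHermitian_conjTranspose_mul_self X
  refine ⟨hX.eigenvectorUnitary, fun i => √(hX.eigenvalues i), ?_, ?_, fun i => Real.sqrt_nonneg _,
    rfl, ?_⟩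
  · exact Unitary.coe_mul_star_self hX.eigenvectorUnitary
  · exact Unitary.coe_star_mul_self hX.eigenvectorUnitary
  · have := hX.conjStarAlgAut_star_eigenvectorUnitary
    rw [Unitary.conjStarAlgAut_star_apply] at this
    rw [← Matrix.star_eq_conjTranspose (hX.eigenvectorUnitary : Matrix ι ι ℂ), this]
    congr 1
    funext i
    rw [Real.sq_sqrt (Matrix.eigenvalues_conjTranspose_mul_self_nonneg X i)]
    rfl

/-- In the eigenbasis `W` of `Xᴴ X` the columns of `S W` have the singular values as norms, and
Cauchy-Schwarz bounds each diagonal entry of `Wᴴ S W`. All lower bounds on trace norms come from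
here, by exhibiting a suitable `S`. -/
theorem trace_re_le_traceNorm {X S : Matrix ι ι ℂ} (h : Sᴴ * S = Xᴴ * X) :
    S.trace.re ≤ traceNorm X := by
  obtain ⟨W, σ, hW, hW', hσ, ht, hd⟩ := exists_singularValues X
  have e1 : S.trace = (Wᴴ * (S * W)).trace := by
    rw [Matrix.trace_mul_comm, Matrix.mul_assoc, hW, Matrix.mul_one]
  rw [e1, ht, Matrix.trace, Complex.re_sum]
  refine Finset.sum_le_sum fun i _ => (Complex.re_le_norm _).trans ?_
  have hcol : ∀ (A B : Matrix ι ι ℂ), (Aᴴ * B) i i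
      = ((A.submatrix id (fun _ : Unit => i))ᴴ * B.submatrix id (fun _ : Unit => i)).trace := by
    intro A B
    simp [Matrix.trace, Matrix.mul_apply]
  have hsq : ∀ A : Matrix ι ι ℂ, hsSq (A.submatrix id (fun _ : Unit => i)) = ((Aᴴ * A) i i).re := by
    intro A
    rw [hcol, hsSq]
  rw [Matrix.diag_apply, hcol]
  refine (norm_trace_conjTranspose_mul_le _ _).trans (le_of_eq ?_)
  rw [hsq, hsq, hW', Matrix.conjTranspose_mul]
  have : Wᴴ * Sᴴ * (S * W) = Wᴴ * (Xᴴ * X) * W := by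
    rw [← h]; simp only [Matrix.mul_assoc]
  rw [this, hd]
  rw [Matrix.diagonal_apply_eq, Matrix.one_apply_eq, Complex.ofReal_re, Real.sqrt_sq (hσ i)]
  simp

/-- `K` is the adjoint of the polar part of `X`, so `K X = |X|`. Being a partial isometry, it costs
nothing in Cauchy-Schwarz. Fixing one `K` for `X` allows `X` to be split into several products
without a triangle inequality for `traceNorm`. -/
theorem exists_traceNorm_eq_trace_mul (X : Matrix ι ι ℂ) :
    ∃ K : Matrix ι ι ℂ, traceNorm X = (K * X).trace.re ∧
      ∀ {n : Type _} [Fintype n] (A B : Matrix ι n ℂ),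
        (K * (A * Bᴴ)).trace.re ≤ √(hsSq A) * √(hsSq B) := by
  obtain ⟨W, σ, hW, hW', hσ, ht, hd⟩ := exists_singularValues X
  -- A pseudo-inverse: the convention `0⁻¹ = 0` handles zero singular values.
  set g : Matrix ι ι ℂ := Matrix.diagonal fun i => (((σ i)⁻¹ : ℝ) : ℂ) with hg
  have hgH : gᴴ = g := by
    rw [hg, Matrix.diagonal_conjTranspose]; congr 1; funext i; simp
  have hd' : Wᴴ * (Xᴴ * (X * W)) = Matrix.diagonal fun i => ((σ i ^ 2 : ℝ) : ℂ) := by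
    rw [← hd]; simp only [Matrix.mul_assoc]
  refine ⟨W * (g * (Wᴴ * Xᴴ)), ?_, ?_⟩
  · have : (W * (g * (Wᴴ * Xᴴ)) * X).trace = (g * (Wᴴ * (Xᴴ * (X * W)))).trace := by
      rw [Matrix.mul_assoc, Matrix.trace_mul_comm]
      simp only [Matrix.mul_assoc]
    rw [this, hd', hg, Matrix.diagonal_mul_diagonal, Matrix.trace_diagonal, Complex.re_sum, ht]
    refine Finset.sum_congr rfl fun i _ => ?_
    rw [← Complex.ofReal_mul, Complex.ofReal_re]
    rcases eq_or_ne (σ i) 0 with h | h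
    · simp [h]
    · field_simp
  · intro n _ A B
    have hK : W * (g * (Wᴴ * Xᴴ)) * (W * (g * (Wᴴ * Xᴴ)))ᴴ * (W * (g * (Wᴴ * Xᴴ)))
        = W * (g * (Wᴴ * Xᴴ)) := by
      have h2 : g * (Matrix.diagonal fun i => ((σ i ^ 2 : ℝ) : ℂ)) * g * g = g := by
        rw [hg]
        simp only [Matrix.diagonal_mul_diagonal]
        congr 1
        funext i
        rcases eq_or_ne (σ i) 0 with h | h
        · simp [h]
        · have : (σ i : ℂ) ≠ 0 := by exact_mod_cast h
          push_cast
          field_simp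
      calc _ = W * (g * (Wᴴ * (Xᴴ * (X * W))) * g * (Wᴴ * W) * (g * (Wᴴ * Xᴴ))) := by
            simp only [Matrix.conjTranspose_mul, Matrix.conjTranspose_conjTranspose, hgH,
              Matrix.mul_assoc]
        _ = W * (g * (Matrix.diagonal fun i => ((σ i ^ 2 : ℝ) : ℂ)) * g * g * (Wᴴ * Xᴴ)) := by
            rw [hd', hW', Matrix.mul_one]
            simp only [Matrix.mul_assoc]
        _ = _ := by rw [h2]
    have h3 := norm_trace_conjTranspose_mul_le B (W * (g * (Wᴴ * Xᴴ)) * A)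
    have h4 := hsSq_mul_le_of_isometry_mul _ hK A
    rw [← Matrix.mul_assoc, Matrix.trace_mul_comm]
    calc _ ≤ _ := Complex.re_le_norm _
      _ ≤ _ := h3
      _ ≤ √(hsSq B) * √(hsSq A) := by gcongr
      _ = _ := mul_comm _ _

theorem traceNorm_mul_conjTranspose_le {n : Type*} [Fintype n] (A B : Matrix ι n ℂ) :
    traceNorm (A * Bᴴ) ≤ √(hsSq A) * √(hsSq B) := by
  obtain ⟨K, hK, h⟩ := exists_traceNorm_eq_trace_mul (A * Bᴴ)
  rw [hK]
  exact h A B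

/-- From the singular value decomposition, each factor receives the square roots of the singular
values. -/
theorem exists_balanced_factorization (X : Matrix ι ι ℂ) :
    ∃ C D : Matrix ι ι ℂ, X = C * Dᴴ ∧ hsSq C = traceNorm X ∧ hsSq D = traceNorm X := by
  obtain ⟨W, σ, hW, hW', hσ, ht, hd⟩ := exists_singularValues X
  have hd' : Wᴴ * (Xᴴ * (X * W)) = Matrix.diagonal fun i => ((σ i ^ 2 : ℝ) : ℂ) := by
    rw [← hd]; simp only [Matrix.mul_assoc]
  have gram : ∀ f : ι → ℝ, hsSq (X * W * Matrix.diagonal fun i => (f i : ℂ))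
      = ∑ i, f i * σ i ^ 2 * f i := by
    intro f
    have : (X * W * Matrix.diagonal fun i => (f i : ℂ))ᴴ * (X * W * Matrix.diagonal fun i => (f i : ℂ))
        = Matrix.diagonal fun i => ((f i * σ i ^ 2 * f i : ℝ) : ℂ) := by
      calc _ = (Matrix.diagonal fun i => (f i : ℂ))ᴴ * (Wᴴ * (Xᴴ * (X * W))) *
            (Matrix.diagonal fun i => (f i : ℂ)) := by
            simp only [Matrix.conjTranspose_mul, Matrix.mul_assoc]
        _ = _ := by
            rw [hd', Matrix.diagonal_conjTranspose, Matrix.diagonal_mul_diagonal,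
              Matrix.diagonal_mul_diagonal]
            congr 1; funext i; simp
    rw [hsSq, this, Matrix.trace_diagonal, Complex.re_sum]
    simp only [Complex.ofReal_re]
  refine ⟨X * W * Matrix.diagonal fun i => (((√(σ i))⁻¹ : ℝ) : ℂ),
    W * Matrix.diagonal fun i => ((√(σ i) : ℝ) : ℂ), ?_, ?_, ?_⟩
  -- The diagonal factor is the projection onto the indices with `σ i = 0`, where the columns of `X
  -- W` vanish.
  · have hz : X * W * Matrix.diagonal (fun i => ((1 - (√(σ i))⁻¹ * √(σ i) : ℝ) : ℂ)) = 0 := by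
      apply hsSq_eq_zero
      rw [gram]
      refine Finset.sum_eq_zero fun i _ => ?_
      rcases (hσ i).eq_or_lt with h | h
      · simp [← h]
      · have := (Real.sqrt_pos.2 h).ne'
        simp [inv_mul_cancel₀ this]
    have hsplit : (Matrix.diagonal fun i => ((1 - (√(σ i))⁻¹ * √(σ i) : ℝ) : ℂ)) =
        1 - (Matrix.diagonal fun i => (((√(σ i))⁻¹ : ℝ) : ℂ)) *
          (Matrix.diagonal fun i => ((√(σ i) : ℝ) : ℂ))ᴴ := by
      rw [Matrix.diagonal_conjTranspose, Matrix.diagonal_mul_diagonal, ← Matrix.diagonal_one,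
        Matrix.diagonal_sub]
      congr 1; funext i; simp
    rw [hsplit, Matrix.mul_sub, Matrix.mul_one, sub_eq_zero] at hz
    calc X = X * W * Wᴴ := by rw [Matrix.mul_assoc, hW, Matrix.mul_one]
      _ = _ := by
        conv_lhs => rw [hz]
        simp only [Matrix.conjTranspose_mul, Matrix.mul_assoc]
  · rw [gram, ht]
    refine Finset.sum_congr rfl fun i _ => ?_
    rcases (hσ i).eq_or_lt with h | h
    · simp [← h]
    · have h1 := (Real.sqrt_pos.2 h).ne'
      have h2 := Real.mul_self_sqrt (hσ i)
      field_simp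
      nlinarith
  · have : (W * Matrix.diagonal fun i => ((√(σ i) : ℝ) : ℂ))ᴴ *
        (W * Matrix.diagonal fun i => ((√(σ i) : ℝ) : ℂ)) = Matrix.diagonal fun i => (σ i : ℂ) := by
      rw [Matrix.conjTranspose_mul, Matrix.mul_assoc, ← Matrix.mul_assoc Wᴴ, hW', Matrix.one_mul,
        Matrix.diagonal_conjTranspose, Matrix.diagonal_mul_diagonal]
      congr 1; funext i
      simp [← Complex.ofReal_mul, Real.mul_self_sqrt (hσ i)]
    rw [hsSq, this, Matrix.trace_diagonal, ht, Complex.re_sum]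
    simp only [Complex.ofReal_re]

end TraceNorm

/-! ### Ancillas, partial trace and block expansion -/

/-- The operator `A ⊗ 1_k`. -/
noncomputable def tensorOne {d : ℕ} (A : Matrix (Fin d) (Fin d) ℂ) (k : ℕ) :
    Matrix (Fin d × Fin k) (Fin d × Fin k) ℂ :=
  A ⊗ₖ (1 : Matrix (Fin k) (Fin k) ℂ)

/-- The partial trace over the ancilla. -/
def partialTrace {d k : ℕ} (X : Matrix (Fin d × Fin k) (Fin d × Fin k) ℂ) :
    Matrix (Fin d) (Fin d) ℂ :=
  Matrix.of fun i j => ∑ a, X (i, a) (j, a)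

/-- Spreads the blocks of rows of `C` indexed by `Fin d` over separate blocks of columns. -/
def blockExpand {d k : ℕ} {r : Type*} (C : Matrix (Fin d × Fin k) r ℂ) :
    Matrix (Fin d × Fin k) (Fin d × r) ℂ :=
  Matrix.of fun p q => if p.1 = q.1 then C p q.2 else 0

section TensorOne

variable {d k : ℕ}

theorem tensorOne_mul (A B : Matrix (Fin d) (Fin d) ℂ) :
    tensorOne A k * tensorOne B k = tensorOne (A * B) k := by
  rw [tensorOne, tensorOne, tensorOne, ← Matrix.mul_kronecker_mul, Matrix.one_mul]

theorem tensorOne_one : tensorOne (1 : Matrix (Fin d) (Fin d) ℂ) k = 1 :=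
  Matrix.one_kronecker_one

theorem conjTranspose_tensorOne (A : Matrix (Fin d) (Fin d) ℂ) :
    (tensorOne A k)ᴴ = tensorOne Aᴴ k := by
  rw [tensorOne, tensorOne, Matrix.conjTranspose_kronecker, Matrix.conjTranspose_one]

theorem tensorOne_mul_apply {r : Type*} (A : Matrix (Fin d) (Fin d) ℂ)
    (C : Matrix (Fin d × Fin k) r ℂ) (i : Fin d) (a : Fin k) (c : r) :
    (tensorOne A k * C) (i, a) c = ∑ j, A i j * C (j, a) c := by
  simp [tensorOne, Matrix.mul_apply, Fintype.sum_prod_type, Matrix.kroneckerMap_apply,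
    Matrix.one_apply]

theorem mul_tensorOne_apply {r : Type*} (A : Matrix (Fin d) (Fin d) ℂ)
    (C : Matrix r (Fin d × Fin k) ℂ) (i : Fin d) (a : Fin k) (c : r) :
    (C * tensorOne A k) c (i, a) = ∑ j, C c (j, a) * A j i := by
  simp [tensorOne, Matrix.mul_apply, Fintype.sum_prod_type, Matrix.kroneckerMap_apply,
    Matrix.one_apply]

theorem partialTrace_tensorOne_mul (A : Matrix (Fin d) (Fin d) ℂ)
    (X : Matrix (Fin d × Fin k) (Fin d × Fin k) ℂ) :
    partialTrace (tensorOne A k * X) = A * partialTrace X := by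
  ext i j
  simp only [partialTrace, Matrix.of_apply, tensorOne_mul_apply, Matrix.mul_apply (M := A),
    Finset.mul_sum]
  exact Finset.sum_comm

theorem partialTrace_mul_tensorOne (A : Matrix (Fin d) (Fin d) ℂ)
    (X : Matrix (Fin d × Fin k) (Fin d × Fin k) ℂ) :
    partialTrace (X * tensorOne A k) = partialTrace X * A := by
  ext i j
  simp only [partialTrace, Matrix.of_apply, mul_tensorOne_apply, Matrix.mul_apply (N := A),
    Finset.sum_mul]
  exact Finset.sum_comm

theorem trace_partialTrace (X : Matrix (Fin d × Fin k) (Fin d × Fin k) ℂ) :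
    (partialTrace X).trace = X.trace := by
  simp [partialTrace, Matrix.trace, Fintype.sum_prod_type]

theorem posSemidef_partialTrace {r : Type*} [Fintype r] (C : Matrix (Fin d × Fin k) r ℂ) :
    (partialTrace (C * Cᴴ)).PosSemidef := by
  have : partialTrace (C * Cᴴ) = (Matrix.of fun (i : Fin d) (q : Fin k × r) => C (i, q.1) q.2) *
      (Matrix.of fun (i : Fin d) (q : Fin k × r) => C (i, q.1) q.2)ᴴ := by
    ext i j
    simp [partialTrace, Matrix.mul_apply, Fintype.sum_prod_type]
  rw [this]
  exact Matrix.posSemidef_self_mul_conjTranspose _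

end TensorOne

/-! ### The measurement channels and the upper bound -/

section Channel

variable {d k : ℕ}

theorem blockExpand_mul_conjTranspose_apply {r : Type*} [Fintype r]
    (C D : Matrix (Fin d × Fin k) r ℂ) (p q : Fin d × Fin k) :
    (blockExpand C * (blockExpand D)ᴴ) p q = if p.1 = q.1 then (C * Dᴴ) p q else 0 := by
  simp only [blockExpand, Matrix.mul_apply, Matrix.conjTranspose_apply, Matrix.of_apply,
    Fintype.sum_prod_type]
  split_ifs with h
  · rw [Finset.sum_eq_single p.1]
    · simp [h]
    · intro b _ hb
      simp [hb.symm]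
    · simp
  · refine Finset.sum_eq_zero fun i _ => Finset.sum_eq_zero fun c _ => ?_
    by_cases hp : p.1 = i
    · have : q.1 ≠ i := fun hq => h (hp.trans hq.symm)
      simp [this]
    · simp [hp]

theorem ampliation_measurement_apply (V : Matrix (Fin d) (Fin d) ℂ)
    (X : Matrix (Fin d × Fin k) (Fin d × Fin k) ℂ) (p q : Fin d × Fin k) :
    ampliation (measurement V) k X p q =
      if p.1 = q.1 then (tensorOne Vᴴ k * X * tensorOne V k) p q else 0 := by
  obtain ⟨i, a⟩ := p
  obtain ⟨j, b⟩ := q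
  simp only [ampliation, measurement, LinearMap.coe_mk, AddHom.coe_mk, Matrix.of_apply,
    Matrix.diagonal_apply]
  split_ifs with h
  · subst h
    rw [Matrix.mul_assoc, tensorOne_mul_apply]
    simp only [mul_tensorOne_apply, dotProduct, Matrix.mulVec, Matrix.col, Matrix.of_apply,
      Pi.star_apply, Matrix.conjTranspose_apply, Matrix.transpose_apply]
  · rfl

/-- The measurement is conjugation by `Vᴴ` followed by erasing the off-diagonal blocks; separate
columns for separate blocks make the erased products vanish, so the output is factored again. -/
theorem ampliation_measurement_mul_conjTranspose {r : Type*} [Fintype r]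
    (V : Matrix (Fin d) (Fin d) ℂ) (C D : Matrix (Fin d × Fin k) r ℂ) :
    ampliation (measurement V) k (C * Dᴴ) =
      blockExpand (tensorOne Vᴴ k * C) * (blockExpand (tensorOne Vᴴ k * D))ᴴ := by
  ext p q
  rw [ampliation_measurement_apply, blockExpand_mul_conjTranspose_apply, Matrix.conjTranspose_mul,
    conjTranspose_tensorOne, Matrix.conjTranspose_conjTranspose]
  simp only [Matrix.mul_assoc]

theorem ampliation_sub_measurement_one {r : Type*} [Fintype r]
    (V : Matrix (Fin d) (Fin d) ℂ) (C D : Matrix (Fin d × Fin k) r ℂ) :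
    ampliation (measurement V - measurement 1) k (C * Dᴴ) =
      blockExpand (tensorOne Vᴴ k * C) * (blockExpand (tensorOne Vᴴ k * D))ᴴ -
        blockExpand C * (blockExpand D)ᴴ := by
  have h : ampliation (measurement V - measurement 1) k (C * Dᴴ) =
      ampliation (measurement V) k (C * Dᴴ) - ampliation (measurement 1) k (C * Dᴴ) := by
    ext p q
    simp [ampliation]
  rw [h, ampliation_measurement_mul_conjTranspose, ampliation_measurement_mul_conjTranspose,
    Matrix.conjTranspose_one, tensorOne_one, Matrix.one_mul, Matrix.one_mul]

theorem blockExpand_add {r : Type*} (C D : Matrix (Fin d × Fin k) r ℂ) :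
    blockExpand (C + D) = blockExpand C + blockExpand D := by
  ext p q
  simp only [blockExpand, Matrix.of_apply, Matrix.add_apply]
  split_ifs <;> simp

theorem blockExpand_sub {r : Type*} (C D : Matrix (Fin d × Fin k) r ℂ) :
    blockExpand (C - D) = blockExpand C - blockExpand D := by
  ext p q
  simp only [blockExpand, Matrix.of_apply, Matrix.sub_apply]
  split_ifs <;> simp

theorem trace_blockExpand {r : Type*} [Fintype r] (C D : Matrix (Fin d × Fin k) r ℂ) :
    (blockExpand C * (blockExpand D)ᴴ).trace = (C * Dᴴ).trace := by
  simp only [Matrix.trace, Matrix.diag_apply, blockExpand_mul_conjTranspose_apply, if_true]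

theorem hsSq_blockExpand {r : Type*} [Fintype r] (C : Matrix (Fin d × Fin k) r ℂ) :
    hsSq (blockExpand C) = hsSq C := by
  rw [hsSq, hsSq, Matrix.trace_mul_comm, trace_blockExpand, Matrix.trace_mul_comm]

theorem hsSq_tensorOne_mul {r : Type*} [Fintype r] {V : Matrix (Fin d) (Fin d) ℂ}
    (hV : V * Vᴴ = 1) (C : Matrix (Fin d × Fin k) r ℂ) : hsSq (tensorOne Vᴴ k * C) = hsSq C := by
  rw [hsSq, hsSq, Matrix.conjTranspose_mul, Matrix.mul_assoc, ← Matrix.mul_assoc _ _ C,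
    conjTranspose_tensorOne, Matrix.conjTranspose_conjTranspose, tensorOne_mul, hV, tensorOne_one,
    Matrix.one_mul]

theorem trace_conjTranspose_mul_tensorOne_mul {r : Type*} [Fintype r]
    (A : Matrix (Fin d) (Fin d) ℂ) (C : Matrix (Fin d × Fin k) r ℂ) :
    (Cᴴ * (tensorOne A k * C)).trace = (A * partialTrace (C * Cᴴ)).trace := by
  rw [Matrix.trace_mul_comm, Matrix.mul_assoc, ← trace_partialTrace, partialTrace_tensorOne_mul]

theorem hsSq_add_sub {m n : Type*} [Fintype m] [Fintype n] (A B : Matrix m n ℂ) :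
    hsSq (A + B) = hsSq A + hsSq B + 2 * (Bᴴ * A).trace.re ∧
      hsSq (A - B) = hsSq A + hsSq B - 2 * (Bᴴ * A).trace.re := by
  have h : (Aᴴ * B).trace.re = (Bᴴ * A).trace.re := by
    rw [← Complex.conj_re, starRingEnd_apply, ← Matrix.trace_conjTranspose, Matrix.conjTranspose_mul,
      Matrix.conjTranspose_conjTranspose]
  constructor <;>
  · simp only [hsSq, Matrix.conjTranspose_add, Matrix.conjTranspose_sub, Matrix.add_mul,
      Matrix.sub_mul, Matrix.mul_add, Matrix.mul_sub, Matrix.trace_add, Matrix.trace_sub,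
      Complex.add_re, Complex.sub_re, h]
    ring

theorem traceNorm_ampliation_sub_le {r : Type*} [Fintype r] {V : Matrix (Fin d) (Fin d) ℂ}
    (hV : V * Vᴴ = 1) {C D : Matrix (Fin d × Fin k) r ℂ} (hC : hsSq C = 1) (hD : hsSq D = 1) :
    traceNorm (ampliation (measurement V - measurement 1) k (C * Dᴴ)) ≤
      √(1 - (Vᴴ * partialTrace (C * Cᴴ)).trace.re) * √(1 + (Vᴴ * partialTrace (D * Dᴴ)).trace.re) +
      √(1 + (Vᴴ * partialTrace (C * Cᴴ)).trace.re) *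
        √(1 - (Vᴴ * partialTrace (D * Dᴴ)).trace.re) := by
  have key : ∀ F : Matrix (Fin d × Fin k) r ℂ, hsSq F = 1 →
      hsSq (blockExpand (tensorOne Vᴴ k * F + F)) =
        2 * (1 + (Vᴴ * partialTrace (F * Fᴴ)).trace.re) ∧
      hsSq (blockExpand (tensorOne Vᴴ k * F - F)) =
        2 * (1 - (Vᴴ * partialTrace (F * Fᴴ)).trace.re) := by
    intro F hF
    rw [hsSq_blockExpand, hsSq_blockExpand, (hsSq_add_sub _ _).1, (hsSq_add_sub _ _).2,
      hsSq_tensorOne_mul hV, hF, trace_conjTranspose_mul_tensorOne_mul]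
    constructor <;> ring
  obtain ⟨K, hK, h⟩ := exists_traceNorm_eq_trace_mul
    (ampliation (measurement V - measurement 1) k (C * Dᴴ))
  have h1 := h (blockExpand (tensorOne Vᴴ k * C - C)) (blockExpand (tensorOne Vᴴ k * D + D))
  have h2 := h (blockExpand (tensorOne Vᴴ k * C + C)) (blockExpand (tensorOne Vᴴ k * D - D))
  -- Polarization: `2(P P'ᴴ - R R'ᴴ) = (P - R)(P' + R')ᴴ + (P + R)(P' - R')ᴴ`.
  have e : 2 * (K * ampliation (measurement V - measurement 1) k (C * Dᴴ)).trace.re =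
      (K * (blockExpand (tensorOne Vᴴ k * C - C) *
        (blockExpand (tensorOne Vᴴ k * D + D))ᴴ)).trace.re +
      (K * (blockExpand (tensorOne Vᴴ k * C + C) *
        (blockExpand (tensorOne Vᴴ k * D - D))ᴴ)).trace.re := by
    rw [ampliation_sub_measurement_one]
    simp only [blockExpand_add, blockExpand_sub, Matrix.conjTranspose_add, Matrix.conjTranspose_sub,
      Matrix.add_mul, Matrix.sub_mul, Matrix.mul_add, Matrix.mul_sub, Matrix.trace_add,
      Matrix.trace_sub, Complex.add_re, Complex.sub_re]
    ring
  rw [(key C hC).2, (key D hD).1, Real.sqrt_mul zero_le_two, Real.sqrt_mul zero_le_two] at h1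
  rw [(key C hC).1, (key D hD).2, Real.sqrt_mul zero_le_two, Real.sqrt_mul zero_le_two] at h2
  have h3 := Real.mul_self_sqrt (zero_le_two (α := ℝ))
  rw [mul_mul_mul_comm, h3] at h1 h2
  rw [hK]
  linarith

theorem abs_trace_mul_partialTrace_le {r : Type*} [Fintype r] {V : Matrix (Fin d) (Fin d) ℂ}
    (hV : V * Vᴴ = 1) {C : Matrix (Fin d × Fin k) r ℂ} (hC : hsSq C = 1) :
    |(Vᴴ * partialTrace (C * Cᴴ)).trace.re| ≤ 1 := by
  rw [← trace_conjTranspose_mul_tensorOne_mul]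
  refine (Complex.abs_re_le_norm _).trans ((norm_trace_conjTranspose_mul_le _ _).trans ?_)
  rw [hsSq_tensorOne_mul hV, hC]
  simp

/-- With `r = cos α` and `t = cos β` the left side is `2 sin((α + β)/2)`, and both angles are at
most `arccos ν`. -/
theorem sqrt_mul_add_sqrt_mul_le {ν r t : ℝ} (hν : 0 ≤ ν) (hr : ν ≤ r) (ht : ν ≤ t) (hr' : r ≤ 1)
    (ht' : t ≤ 1) :
    √(1 - r) * √(1 + t) + √(1 + r) * √(1 - t) ≤ 2 * √(1 - ν ^ 2) := by
  have e : 2 * √(1 - ν ^ 2) = √(4 * (1 - ν ^ 2)) := by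
    rw [Real.sqrt_mul (by norm_num), show (4 : ℝ) = 2 ^ 2 by norm_num, Real.sqrt_sq (by norm_num)]
  rw [e]
  apply Real.le_sqrt_of_sq_le
  rw [← Real.sqrt_mul (by linarith), ← Real.sqrt_mul (by linarith)]
  have h1 := Real.sq_sqrt (mul_nonneg (by linarith : 0 ≤ 1 - r) (by linarith : 0 ≤ 1 + t))
  have h2 := Real.sq_sqrt (mul_nonneg (by linarith : 0 ≤ 1 + r) (by linarith : 0 ≤ 1 - t))
  have h3 : √((1 - r) * (1 + t)) * √((1 + r) * (1 - t)) ≤ 1 - ν ^ 2 := by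
    rw [← Real.sqrt_mul (mul_nonneg (by linarith) (by linarith))]
    apply Real.sqrt_le_iff.2
    have hr2 : ν ^ 2 ≤ r ^ 2 := by gcongr
    have ht2 : ν ^ 2 ≤ t ^ 2 := by gcongr
    have hr3 : r ^ 2 ≤ 1 := by nlinarith
    refine ⟨by linarith, ?_⟩
    nlinarith [mul_le_mul (by linarith : 1 - r ^ 2 ≤ 1 - ν ^ 2) (by linarith : 1 - t ^ 2 ≤ 1 - ν ^ 2)
      (by nlinarith) (by linarith)]
  have h4 : ν ^ 2 ≤ r * t := by nlinarith [mul_le_mul hr ht hν (hν.trans hr)]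
  nlinarith

theorem traceNorm_ampliation_sub_le_of_le {r : Type*} [Fintype r] {V : Matrix (Fin d) (Fin d) ℂ}
    (hV : V * Vᴴ = 1) {C D : Matrix (Fin d × Fin k) r ℂ} (hC : hsSq C = 1) (hD : hsSq D = 1)
    {ν : ℝ} (hν : 0 ≤ ν) (hνC : ν ≤ (Vᴴ * partialTrace (C * Cᴴ)).trace.re)
    (hνD : ν ≤ (Vᴴ * partialTrace (D * Dᴴ)).trace.re) :
    traceNorm (ampliation (measurement V - measurement 1) k (C * Dᴴ)) ≤ 2 * √(1 - ν ^ 2) :=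
  (traceNorm_ampliation_sub_le hV hC hD).trans (sqrt_mul_add_sqrt_mul_le hν hνC hνD
    (le_of_abs_le (abs_trace_mul_partialTrace_le hV hC))
    (le_of_abs_le (abs_trace_mul_partialTrace_le hV hD)))

end Channel

/-! ### Density matrices: factorization, compactness, convexity -/

section DensityMatrices

variable {d : ℕ}

theorem exists_eq_mul_conjTranspose_of_rank_le {ρ : Matrix (Fin d) (Fin d) ℂ} (hρ : ρ.PosSemidef)
    {k : ℕ} (hk : ρ.rank ≤ k) : ∃ B : Matrix (Fin d) (Fin k) ℂ, ρ = B * Bᴴ := by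
  classical
  rw [hρ.1.rank_eq_card_non_zero_eigs] at hk
  obtain ⟨f⟩ := Function.Embedding.nonempty_of_card_le
    (hk.trans (Fintype.card_fin k).ge)
  set lam := hρ.1.eigenvalues with hlam
  let W : Matrix (Fin d) (Fin d) ℂ := (hρ.1.eigenvectorUnitary : Matrix (Fin d) (Fin d) ℂ)
  -- `J` places the nonzero eigenvalues in distinct columns among `k`; `J Jᴴ` is the projection onto
  -- their indices.
  set J : Matrix (Fin d) (Fin k) ℂ :=
    Matrix.of fun l a => if h : lam l ≠ 0 then (if f ⟨l, h⟩ = a then 1 else 0) else 0 with hJ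
  have hJJ : J * Jᴴ = Matrix.diagonal fun l => if lam l ≠ 0 then (1 : ℂ) else 0 := by
    ext l m
    simp only [hJ, Matrix.mul_apply, Matrix.conjTranspose_apply, Matrix.of_apply,
      Matrix.diagonal_apply]
    by_cases hl : lam l = 0
    · simp [hl]
    by_cases hm : lam m = 0
    · have : l ≠ m := fun h => hl (h ▸ hm)
      simp [hm, this]
    · simp [hl, hm, apply_ite, eq_comm]
  have spec : ρ = W * Matrix.diagonal (fun l => (lam l : ℂ)) * Wᴴ := by
    conv_lhs => rw [hρ.1.spectral_theorem, Unitary.conjStarAlgAut_apply]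
    rfl
  refine ⟨W * Matrix.diagonal (fun l => ((√(lam l) : ℝ) : ℂ)) * J, ?_⟩
  calc ρ = W * (Matrix.diagonal (fun l => ((√(lam l) : ℝ) : ℂ)) * (J * Jᴴ) *
        (Matrix.diagonal (fun l => ((√(lam l) : ℝ) : ℂ)))ᴴ) * Wᴴ := by
        rw [hJJ, Matrix.diagonal_conjTranspose, Matrix.diagonal_mul_diagonal,
          Matrix.diagonal_mul_diagonal]
        conv_lhs => rw [spec]
        congr 3
        funext l
        by_cases hl : lam l = 0
        · simp [hl]
        · have := Real.mul_self_sqrt (hρ.eigenvalues_nonneg l)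
          simp [← Complex.ofReal_mul, hlam, this]
    _ = _ := by simp only [Matrix.conjTranspose_mul, Matrix.mul_assoc]

theorem densityMatrices_eq_image :
    densityMatrices d = (fun B : Matrix (Fin d) (Fin d) ℂ => B * Bᴴ) '' {B | hsSq B = 1} := by
  ext ρ
  constructor
  · rintro ⟨hρ, ht⟩
    obtain ⟨B, rfl⟩ := exists_eq_mul_conjTranspose_of_rank_le hρ (Matrix.rank_le_height ρ)
    refine ⟨B, ?_, rfl⟩
    rw [Matrix.trace_mul_comm, trace_conjTranspose_mul_self] at ht
    exact_mod_cast ht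
  · rintro ⟨B, hB, rfl⟩
    refine ⟨Matrix.posSemidef_self_mul_conjTranspose B, ?_⟩
    rw [Matrix.trace_mul_comm, trace_conjTranspose_mul_self, hB]
    simp

theorem isCompact_densityMatrices : IsCompact (densityMatrices d) := by
  rw [densityMatrices_eq_image]
  refine IsCompact.image ?_ (by fun_prop)
  have hc : Continuous fun B : Matrix (Fin d) (Fin d) ℂ => hsSq B := by
    unfold hsSq; fun_prop
  refine IsCompact.of_isClosed_subset (s := Set.pi Set.univ fun _ : Fin d => Set.pi Set.univ
    fun _ : Fin d => Metric.closedBall (0 : ℂ) 1) ?_ (isClosed_singleton.preimage hc) ?_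
  · exact isCompact_univ_pi fun _ => isCompact_univ_pi fun _ => isCompact_closedBall _ _
  · intro (B : Matrix (Fin d) (Fin d) ℂ) hB i _ j _
    have h1 : hsSq B = 1 := hB
    rw [hsSq_eq_sum] at h1
    have h2 : ‖B i j‖ ^ 2 ≤ 1 := by
      rw [← h1]
      exact (Finset.single_le_sum (f := fun j => ‖B i j‖ ^ 2) (fun _ _ => by positivity)
        (Finset.mem_univ j)).trans (Finset.single_le_sum (f := fun i => ∑ j, ‖B i j‖ ^ 2)
        (fun _ _ => by positivity) (Finset.mem_univ i))
    rw [mem_closedBall_zero_iff]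
    exact (sq_le_one_iff₀ (norm_nonneg _)).1 h2

theorem vecMulVec_mem_densityMatrices {x : Fin d → ℂ} (hx : ∑ i, ‖x i‖ ^ 2 = 1) :
    Matrix.vecMulVec x (star x) ∈ densityMatrices d := by
  refine ⟨Matrix.posSemidef_vecMulVec_self_star x, ?_⟩
  simp only [Matrix.trace, Matrix.diag_apply, Matrix.vecMulVec_apply, Pi.star_apply,
    RCLike.star_def, Complex.mul_conj']
  exact_mod_cast hx

theorem densityMatrices_nonempty (hd : 0 < d) : (densityMatrices d).Nonempty := by
  refine ⟨_, vecMulVec_mem_densityMatrices (x := Pi.single ⟨0, hd⟩ 1) ?_⟩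
  rw [Finset.sum_eq_single ⟨0, hd⟩] <;> simp +contextual

theorem convex_densityMatrices : Convex ℝ (densityMatrices d) := by
  rintro ρ ⟨hρ, hρt⟩ τ ⟨hτ, hτt⟩ a b ha hb hab
  refine ⟨(hρ.smul ha).add (hτ.smul hb), ?_⟩
  rw [Matrix.trace_add, Matrix.trace_smul, Matrix.trace_smul, hρt, hτt]
  simp only [Complex.real_smul, mul_one]
  exact_mod_cast hab

theorem exists_isLeast_densityMatrices (hd : 0 < d) {f : Matrix (Fin d) (Fin d) ℂ → ℝ}
    (hf : Continuous f) : ∃ ρ ∈ densityMatrices d, IsLeast (f '' densityMatrices d) (f ρ) := by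
  obtain ⟨ρ, hρ, hmin⟩ := isCompact_densityMatrices.exists_isMinOn (densityMatrices_nonempty hd)
    hf.continuousOn
  refine ⟨ρ, hρ, ⟨ρ, hρ, rfl⟩, ?_⟩
  rintro _ ⟨τ, hτ, rfl⟩
  exact hmin hτ

theorem norm_diag_conjTranspose_mul {ρ : Matrix (Fin d) (Fin d) ℂ} (hρ : ρ.IsHermitian)
    (U : Matrix (Fin d) (Fin d) ℂ) (i : Fin d) : ‖(Uᴴ * ρ) i i‖ = ‖(ρ * U) i i‖ := by
  have : (Uᴴ * ρ) i i = star ((ρ * U) i i) := by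
    rw [← Matrix.conjTranspose_apply, Matrix.conjTranspose_mul, hρ.eq]
  rw [this, norm_star]

theorem l1Norm_diag_conjTranspose_mul {ρ : Matrix (Fin d) (Fin d) ℂ} (hρ : ρ.IsHermitian)
    (U : Matrix (Fin d) (Fin d) ℂ) : l1Norm (Uᴴ * ρ).diag = ∑ i, ‖(ρ * U) i i‖ :=
  Finset.sum_congr rfl fun i _ => norm_diag_conjTranspose_mul hρ U i

end DensityMatrices

/-! ### Duality: a separating functional and its replacement by a unitary -/

section Duality

variable {d : ℕ}

/-- Hahn-Banach separates the open taxicab ball of radius `ν` from the convex set of diagonals of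
`ρU`; the dual of the taxicab norm is the sup norm. -/
theorem exists_dual_vector {U : Matrix (Fin d) (Fin d) ℂ} {ν : ℝ} (hν : 0 < ν)
    (hmin : ∀ ρ ∈ densityMatrices d, ν ≤ ∑ i, ‖(ρ * U) i i‖) :
    ∃ e : Fin d → ℂ, (∀ i, ‖e i‖ ≤ 1) ∧
      ∀ ρ ∈ densityMatrices d, ν ≤ (∑ i, (ρ * U) i i * e i).re := by
  set ball : Set (Fin d → ℂ) := {v | ∑ i, ‖v i‖ < ν} with hball
  have hconv : Convex ℝ ball := by
    intro v hv w hw a b ha hb hab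
    refine lt_of_le_of_lt ?_ (Set.mem_Iio.1 (convex_Iio ν (Set.mem_Iio.2 hv) (Set.mem_Iio.2 hw) ha hb hab))
    rw [smul_eq_mul, smul_eq_mul, Finset.mul_sum, Finset.mul_sum, ← Finset.sum_add_distrib]
    refine Finset.sum_le_sum fun i _ => (norm_add_le _ _).trans ?_
    simp [abs_of_nonneg ha, abs_of_nonneg hb]
  have hopen : IsOpen ball := isOpen_lt (by fun_prop) continuous_const
  have hlin : IsLinearMap ℝ fun (ρ : Matrix (Fin d) (Fin d) ℂ) (i : Fin d) => (ρ * U) i i := by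
    constructor
    · intro ρ τ; funext i; simp [Matrix.add_mul]
    · intro c ρ; funext i; simp
  obtain ⟨f, s, hf, hs⟩ := RCLike.geometric_hahn_banach_open (𝕜 := ℂ) hconv hopen
    (convex_densityMatrices.is_linear_image hlin) (by
      rw [Set.disjoint_right]
      rintro _ ⟨ρ, hρ, rfl⟩ h
      exact (hmin ρ hρ).not_gt h)
  have hspos : 0 < s := by
    have := hf 0 (by simpa [hball] using hν)
    simpa using this
  have hfe : ∀ v : Fin d → ℂ, f v = ∑ i, v i * f (Pi.single i 1) := by
    intro v
    conv_lhs => rw [← Finset.univ_sum_single v, map_sum]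
    refine Finset.sum_congr rfl fun i _ => ?_
    have : (Pi.single i (v i) : Fin d → ℂ) = v i • Pi.single i 1 := by
      rw [← Pi.single_smul]; simp
    rw [this, map_smul, smul_eq_mul]
  have hbound : ∀ i, ν * ‖f (Pi.single i 1)‖ ≤ s := by
    intro i
    set z := f (Pi.single i 1) with hz
    by_contra! h
    have hz0 : 0 < ‖z‖ := by
      by_contra! h0
      have : ‖z‖ = 0 := le_antisymm h0 (norm_nonneg _)
      rw [this] at h
      linarith
    have hz1 : (‖z‖ : ℂ) ≠ 0 := by exact_mod_cast hz0.ne'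
    -- This vector is aligned with the `i`-th coefficient so that `f` equals `s` on it exactly,
    -- contradicting `f < s` on the ball.
    have hmem : (Pi.single i (((s / ‖z‖ : ℝ) : ℂ) * (starRingEnd ℂ z / ‖z‖)) : Fin d → ℂ) ∈ ball := by
      have : ∑ j, ‖(Pi.single i (((s / ‖z‖ : ℝ) : ℂ) * (starRingEnd ℂ z / ‖z‖)) : Fin d → ℂ) j‖
          = s / ‖z‖ := by
        rw [Finset.sum_eq_single i]
        · rw [Pi.single_eq_same, norm_mul, norm_div, RCLike.norm_conj, Complex.norm_real,
            Complex.norm_real, norm_norm, div_self hz0.ne', mul_one, Real.norm_of_nonneg]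
          positivity
        · intro j _ hj
          simp [hj]
        · simp
      rw [hball, Set.mem_ofPred_eq, this, div_lt_iff₀ hz0]
      exact h
    have h1 := hf _ hmem
    rw [hfe, Finset.sum_eq_single i] at h1
    · rw [Pi.single_eq_same, ← hz] at h1
      have h2 : ((s / ‖z‖ : ℝ) : ℂ) * (starRingEnd ℂ z / ‖z‖) * z = (s : ℂ) := by
        have h3 : starRingEnd ℂ z * z = (‖z‖ : ℂ) ^ 2 := Complex.conj_mul' z
        push_cast
        field_simp
        linear_combination h3
      rw [h2] at h1
      simp at h1
    · intro j _ hj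
      simp [hj]
    · simp
  -- Rescaling moves the separating level from `s` to `ν`.
  refine ⟨fun i => ((ν / s : ℝ) : ℂ) * f (Pi.single i 1), fun i => ?_, fun ρ hρ => ?_⟩
  · rw [norm_mul, Complex.norm_real, Real.norm_of_nonneg (by positivity), div_mul_eq_mul_div,
      div_le_one hspos]
    exact hbound i
  · have h1 := hs _ ⟨ρ, hρ, rfl⟩
    rw [hfe] at h1
    have h2 : ∑ i, (ρ * U) i i * (((ν / s : ℝ) : ℂ) * f (Pi.single i 1)) =
        ((ν / s : ℝ) : ℂ) * ∑ i, (ρ * U) i i * f (Pi.single i 1) := by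
      rw [Finset.mul_sum]
      exact Finset.sum_congr rfl fun i _ => by ring
    rw [h2, Complex.re_ofReal_mul]
    calc ν = ν / s * s := by field_simp
      _ ≤ _ := by
        gcongr
        exact h1

theorem star_dotProduct_self (x : Fin d → ℂ) : star x ⬝ᵥ x = ((∑ i, ‖x i‖ ^ 2 : ℝ) : ℂ) := by
  simp [dotProduct, Complex.conj_mul']

theorem star_dotProduct_add_conjTranspose_sub_mulVec (A : Matrix (Fin d) (Fin d) ℂ) (ν : ℝ)
    (x : Fin d → ℂ) :
    (star x ⬝ᵥ ((A + Aᴴ - (2 * ν : ℂ) • (1 : Matrix (Fin d) (Fin d) ℂ)) *ᵥ x)).re =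
      2 * (star x ⬝ᵥ (A *ᵥ x)).re - 2 * ν * ∑ i, ‖x i‖ ^ 2 := by
  have h : (star x ⬝ᵥ (Aᴴ *ᵥ x)).re = (star x ⬝ᵥ (A *ᵥ x)).re := by
    rw [← Complex.conj_re (star x ⬝ᵥ (A *ᵥ x)), starRingEnd_apply, Matrix.star_dotProduct,
      Matrix.star_mulVec, Matrix.dotProduct_mulVec]
    simp
  rw [Matrix.sub_mulVec, Matrix.add_mulVec, Matrix.smul_mulVec, Matrix.one_mulVec,
    dotProduct_sub, dotProduct_add, dotProduct_smul, star_dotProduct_self, Complex.sub_re,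
    Complex.add_re, h, smul_eq_mul, ← Complex.ofReal_ofNat, ← Complex.ofReal_mul,
    Complex.re_ofReal_mul, Complex.ofReal_re]
  ring

theorem isHermitian_add_conjTranspose_sub (A : Matrix (Fin d) (Fin d) ℂ) (ν : ℝ) :
    (A + Aᴴ - (2 * ν : ℂ) • (1 : Matrix (Fin d) (Fin d) ℂ)).IsHermitian := by
  rw [Matrix.IsHermitian, Matrix.conjTranspose_sub, Matrix.conjTranspose_add,
    Matrix.conjTranspose_conjTranspose, Matrix.conjTranspose_smul, Matrix.conjTranspose_one,
    add_comm]
  simp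

/-- Testing on the pure states of the eigenvectors is enough. -/
theorem posSemidef_of_forall_le_trace {A : Matrix (Fin d) (Fin d) ℂ} {ν : ℝ}
    (h : ∀ ρ ∈ densityMatrices d, ν ≤ (ρ * A).trace.re) :
    (A + Aᴴ - (2 * ν : ℂ) • (1 : Matrix (Fin d) (Fin d) ℂ)).PosSemidef := by
  have hH := isHermitian_add_conjTranspose_sub A ν
  rw [hH.posSemidef_iff_eigenvalues_nonneg]
  intro j
  set y : Fin d → ℂ := ⇑(hH.eigenvectorBasis j) with hy
  have hy1 : ∑ i, ‖y i‖ ^ 2 = 1 := by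
    rw [hy, ← EuclideanSpace.norm_sq_eq, hH.eigenvectorBasis.orthonormal.1 j, one_pow]
  have h1 := h _ (vecMulVec_mem_densityMatrices hy1)
  rw [Matrix.vecMulVec_mul, Matrix.trace_vecMulVec, dotProduct_comm, ← Matrix.dotProduct_mulVec]
    at h1
  rw [hH.eigenvalues_eq, ← hy]
  have h2 := star_dotProduct_add_conjTranspose_sub_mulVec A ν y
  rw [hy1] at h2
  rw [Pi.zero_apply]
  refine le_of_le_of_eq ?_ h2.symm
  linarith

/-- The exact formula for the gap is kept because its vanishing gives complementary slackness. -/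
theorem le_trace_re_of_posSemidef {A : Matrix (Fin d) (Fin d) ℂ} {ν : ℝ}
    (h : (A + Aᴴ - (2 * ν : ℂ) • (1 : Matrix (Fin d) (Fin d) ℂ)).PosSemidef)
    {ρ : Matrix (Fin d) (Fin d) ℂ} (hρ : ρ ∈ densityMatrices d) :
    2 * ((ρ * A).trace.re - ν) = (ρ * (A + Aᴴ - (2 * ν : ℂ) • 1)).trace.re ∧
      ν ≤ (ρ * A).trace.re := by
  have h1 : (ρ * Aᴴ).trace.re = (ρ * A).trace.re := by
    rw [← Complex.conj_re (ρ * A).trace, starRingEnd_apply, ← Matrix.trace_conjTranspose,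
      Matrix.conjTranspose_mul, hρ.1.1.eq, Matrix.trace_mul_comm]
  have h2 : 2 * ((ρ * A).trace.re - ν) = (ρ * (A + Aᴴ - (2 * ν : ℂ) • 1)).trace.re := by
    rw [Matrix.mul_sub, Matrix.mul_add, Matrix.trace_sub, Matrix.trace_add, Matrix.mul_smul,
      Matrix.mul_one, Matrix.trace_smul, hρ.2, Complex.sub_re, Complex.add_re, h1]
    simp
    ring
  refine ⟨h2, ?_⟩
  obtain ⟨B, hB⟩ := exists_eq_mul_conjTranspose_of_rank_le hρ.1 (Matrix.rank_le_height ρ)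
  have h3 := (h.conjTranspose_mul_mul_same B).trace_nonneg
  rw [Matrix.mul_assoc, Matrix.trace_mul_comm, Matrix.mul_assoc, ← hB, Matrix.trace_mul_comm] at h3
  have h4 := (Complex.le_def.1 h3).1
  rw [Complex.zero_re, ← h2] at h4
  linarith

/-- An eigenvector of a unitary `V` is also one of `Vᴴ`, so the quadratic form of `V diag(r)` at `x`
is `z ∑ rᵢ|xᵢ|²`. Its real part is at least `ν‖x‖² > 0`, hence `Re z ≥ 0`, and replacing each `rᵢ ≤
1` by 1 only helps. -/
theorem le_re_eigenvalue {V : Matrix (Fin d) (Fin d) ℂ} (hV : Vᴴ * V = 1) {r : Fin d → ℝ}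
    (hr : ∀ i, r i ≤ 1) (hr0 : ∀ i, 0 ≤ r i) {ν : ℝ} (hν : 0 < ν)
    (h : (V * Matrix.diagonal (fun i => (r i : ℂ)) + (V * Matrix.diagonal fun i => (r i : ℂ))ᴴ -
      (2 * ν : ℂ) • (1 : Matrix (Fin d) (Fin d) ℂ)).PosSemidef)
    {x : Fin d → ℂ} (hx : x ≠ 0) {z : ℂ} (hz : V *ᵥ x = z • x) :
    ν ≤ z.re ∧ starRingEnd ℂ z * z = 1 := by
  have hpos : 0 < ∑ i, ‖x i‖ ^ 2 := by
    obtain ⟨i, hi⟩ := Function.ne_iff.1 hx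
    exact Finset.sum_pos' (fun _ _ => by positivity)
      ⟨i, Finset.mem_univ i, by have := norm_pos_iff.2 hi; positivity⟩
  have hxx : star x ⬝ᵥ x ≠ 0 := by
    rw [star_dotProduct_self]; exact_mod_cast hpos.ne'
  have hzz : starRingEnd ℂ z * z = 1 := by
    have h1 : star (V *ᵥ x) ⬝ᵥ (V *ᵥ x) = star x ⬝ᵥ x := by
      rw [Matrix.star_mulVec, ← Matrix.dotProduct_mulVec, Matrix.mulVec_mulVec, hV,
        Matrix.one_mulVec]
    rw [hz, star_smul, smul_dotProduct, dotProduct_smul, smul_smul, smul_eq_mul] at h1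
    exact mul_right_cancel₀ hxx (h1.trans (one_mul _).symm)
  refine ⟨?_, hzz⟩
  have hVx : Vᴴ *ᵥ x = starRingEnd ℂ z • x := by
    have h1 : Vᴴ *ᵥ (V *ᵥ x) = x := by rw [Matrix.mulVec_mulVec, hV, Matrix.one_mulVec]
    rw [hz, Matrix.mulVec_smul] at h1
    conv_rhs => rw [← h1]
    rw [smul_smul, hzz, one_smul]
  have hq : star x ⬝ᵥ ((V * Matrix.diagonal fun i => (r i : ℂ)) *ᵥ x) =
      z * ((∑ i, r i * ‖x i‖ ^ 2 : ℝ) : ℂ) := by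
    rw [← Matrix.mulVec_mulVec, Matrix.dotProduct_mulVec]
    have : star x ᵥ* V = z • star x := by
      have := congrArg star hVx
      rw [Matrix.star_mulVec, Matrix.conjTranspose_conjTranspose, star_smul] at this
      simpa using this
    rw [this, smul_dotProduct, smul_eq_mul]
    congr 1
    simp only [dotProduct, Matrix.mulVec_diagonal, Pi.star_apply, RCLike.star_def]
    push_cast
    exact Finset.sum_congr rfl fun i _ => by rw [← Complex.conj_mul']; ring
  have h1 := h.re_dotProduct_nonneg x
  rw [RCLike.re_eq_complex_re, star_dotProduct_add_conjTranspose_sub_mulVec, hq, Complex.re_mul_ofReal] at h1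
  have h2 : ∑ i, r i * ‖x i‖ ^ 2 ≤ ∑ i, ‖x i‖ ^ 2 :=
    Finset.sum_le_sum fun i _ => mul_le_of_le_one_left (by positivity) (hr i)
  have h3 : 0 ≤ ∑ i, r i * ‖x i‖ ^ 2 :=
    Finset.sum_nonneg fun i _ => mul_nonneg (hr0 i) (by positivity)
  have h4 : ν * ∑ i, ‖x i‖ ^ 2 ≤ z.re * ∑ i, r i * ‖x i‖ ^ 2 := by linarith
  have h5 : 0 ≤ z.re := by
    by_contra! h0
    nlinarith [mul_pos hν hpos]
  exact le_of_mul_le_mul_right (h4.trans (mul_le_mul_of_nonneg_left h2 h5)) hpos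

/-- Every eigenvalue of `V + Vᴴ` is `2 Re w` for an eigenvalue `w` of `V`, so `le_re_eigenvalue`
suffices. -/
theorem posSemidef_unitary_of_contraction {V : Matrix (Fin d) (Fin d) ℂ} (hV : Vᴴ * V = 1)
    (hV' : V * Vᴴ = 1) {r : Fin d → ℝ} (hr : ∀ i, r i ≤ 1) (hr0 : ∀ i, 0 ≤ r i) {ν : ℝ} (hν : 0 < ν)
    (h : (V * Matrix.diagonal (fun i => (r i : ℂ)) + (V * Matrix.diagonal fun i => (r i : ℂ))ᴴ -
      (2 * ν : ℂ) • (1 : Matrix (Fin d) (Fin d) ℂ)).PosSemidef) :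
    (V + Vᴴ - (2 * ν : ℂ) • (1 : Matrix (Fin d) (Fin d) ℂ)).PosSemidef := by
  have hH := isHermitian_add_conjTranspose_sub V ν
  rw [hH.posSemidef_iff_eigenvalues_nonneg]
  intro j
  set y : Fin d → ℂ := ⇑(hH.eigenvectorBasis j) with hy
  have hy0 : y ≠ 0 := by
    have := hH.eigenvectorBasis.orthonormal.ne_zero j
    intro h0
    exact this (by ext i; exact congrFun h0 i)
  set m : ℂ := (hH.eigenvalues j : ℂ) + 2 * ν with hm
  have hVy : V *ᵥ y + Vᴴ *ᵥ y = m • y := by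
    have h1 := hH.mulVec_eigenvectorBasis j
    rw [← hy, Matrix.sub_mulVec, Matrix.add_mulVec, Matrix.smul_mulVec, Matrix.one_mulVec,
      sub_eq_iff_eq_add] at h1
    rw [h1, hm, add_smul]
    rfl
  have hVVy : V *ᵥ (V *ᵥ y) = m • (V *ᵥ y) - y := by
    have h1 := congrArg (fun w => V *ᵥ w) hVy
    simp only [Matrix.mulVec_add, Matrix.mulVec_smul, Matrix.mulVec_mulVec (M := V) (N := Vᴴ), hV', Matrix.one_mulVec] at h1
    rw [← h1]; abel
  -- Since `V² y = m V y - y`, a root `z` gives `(V - z)(V - (m - z)) y = 0`; so either `y` or `V y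
  -- - (m - z) y` is an eigenvector of `V`.
  obtain ⟨z, hz⟩ : ∃ z : ℂ, z ^ 2 - m * z + 1 = 0 := by
    obtain ⟨s, hs⟩ := IsAlgClosed.exists_pow_nat_eq (m ^ 2 - 4) zero_lt_two
    exact ⟨(m + s) / 2, by linear_combination hs / 4⟩
  obtain ⟨x, w, hx, hxw, hw⟩ : ∃ (x : Fin d → ℂ) (w : ℂ), x ≠ 0 ∧ V *ᵥ x = w • x ∧
      w ^ 2 - m * w + 1 = 0 := by
    by_cases h0 : V *ᵥ y - (m - z) • y = 0
    · exact ⟨y, m - z, hy0, sub_eq_zero.1 h0, by linear_combination hz⟩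
    · refine ⟨_, z, h0, ?_, hz⟩
      rw [Matrix.mulVec_sub, Matrix.mulVec_smul, hVVy, smul_sub, smul_smul]
      have : z * (m - z) = 1 := by linear_combination -hz
      rw [this, one_smul, sub_smul]
      abel
  obtain ⟨h1, h2⟩ := le_re_eigenvalue hV hr hr0 hν h hx hxw
  have h3 : m = w + starRingEnd ℂ w := by
    linear_combination -(starRingEnd ℂ w) * hw + (w - m) * h2
  have h4 := congrArg Complex.re h3
  simp [hm] at h4
  rw [Pi.zero_apply]
  linarith

end Duality

/-! ### Diagonal unitaries and strong duality -/

section DiagonalUnitaries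

variable {d : ℕ}

theorem diagonal_mem_diagUnitaries {f : Fin d → ℂ} (hf : ∀ i, ‖f i‖ = 1) :
    Matrix.diagonal f ∈ diagUnitaries d := by
  refine ⟨?_, Matrix.isDiag_diagonal f⟩
  rw [Matrix.mem_unitaryGroup_iff, Matrix.star_eq_conjTranspose, Matrix.diagonal_conjTranspose,
    Matrix.diagonal_mul_diagonal, ← Matrix.diagonal_one]
  congr 1
  funext i
  rw [Pi.star_apply, RCLike.star_def, Complex.mul_conj', hf i]
  simp

theorem exists_eq_diagonal_of_mem_diagUnitaries {E : Matrix (Fin d) (Fin d) ℂ}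
    (hE : E ∈ diagUnitaries d) : ∃ f : Fin d → ℂ, (∀ i, ‖f i‖ = 1) ∧ E = Matrix.diagonal f := by
  obtain ⟨h1, h2⟩ := hE
  refine ⟨E.diag, fun i => ?_, h2.diagonal_diag.symm⟩
  rw [Matrix.mem_unitaryGroup_iff, Matrix.star_eq_conjTranspose, ← h2.diagonal_diag,
    Matrix.diagonal_conjTranspose, Matrix.diagonal_mul_diagonal] at h1
  have h3 := congrFun (congrFun h1 i) i
  rw [Matrix.diagonal_apply_eq, Matrix.one_apply_eq, Pi.star_apply, RCLike.star_def,
    Complex.mul_conj'] at h3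
  have h4 : ‖E.diag i‖ ^ 2 = 1 := by exact_mod_cast h3
  exact (pow_eq_one_iff_of_nonneg (norm_nonneg _) two_ne_zero).1 h4

theorem measurement_mul_diagonal (U : Matrix (Fin d) (Fin d) ℂ) {f : Fin d → ℂ}
    (hf : ∀ i, ‖f i‖ = 1) : measurement (U * Matrix.diagonal f) = measurement U := by
  ext1 ρ
  simp only [measurement, LinearMap.coe_mk, AddHom.coe_mk]
  congr 1
  funext i
  have hcol : (U * Matrix.diagonal f).col i = f i • U.col i := by
    funext j
    simp [Matrix.col, mul_comm]
  rw [hcol, star_smul, smul_dotProduct, Matrix.mulVec_smul, dotProduct_smul, smul_smul,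
    RCLike.star_def, Complex.conj_mul', hf i]
  simp

theorem exists_phase (z : ℂ) : ∃ f : ℂ, ‖f‖ = 1 ∧ z * f = ‖z‖ := by
  rcases eq_or_ne z 0 with rfl | h
  · exact ⟨1, by simp⟩
  · have hn : ‖z‖ ≠ 0 := norm_ne_zero_iff.2 h
    have hc : (‖z‖ : ℂ) ≠ 0 := by exact_mod_cast hn
    refine ⟨starRingEnd ℂ z / ‖z‖, by simp [hn], ?_⟩
    rw [← mul_div_assoc, Complex.mul_conj', sq, mul_div_assoc, div_self hc, mul_one]

theorem mul_diagonal_unitary {U : Matrix (Fin d) (Fin d) ℂ} (hU : U ∈ Matrix.unitaryGroup (Fin d) ℂ)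
    {f : Fin d → ℂ} (hf : ∀ i, ‖f i‖ = 1) :
    (U * Matrix.diagonal f)ᴴ * (U * Matrix.diagonal f) = 1 ∧
      (U * Matrix.diagonal f) * (U * Matrix.diagonal f)ᴴ = 1 := by
  have h := mul_mem hU (diagonal_mem_diagUnitaries hf).1
  exact ⟨Matrix.mem_unitaryGroup_iff'.1 h, Matrix.mem_unitaryGroup_iff.1 h⟩

theorem mul_mul_diagonal_apply_self (ρ U : Matrix (Fin d) (Fin d) ℂ) (f : Fin d → ℂ) (i : Fin d) :
    (ρ * (U * Matrix.diagonal f)) i i = (ρ * U) i i * f i := by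
  rw [← Matrix.mul_assoc, Matrix.mul_diagonal]

/-- Strong duality: the minimum of the convex program is attained by a diagonal unitary. -/
theorem exists_dual_unitary {U : Matrix (Fin d) (Fin d) ℂ}
    (hU : U ∈ Matrix.unitaryGroup (Fin d) ℂ) {ν : ℝ} (hν : 0 < ν)
    (hmin : ∀ ρ ∈ densityMatrices d, ν ≤ ∑ i, ‖(ρ * U) i i‖) :
    ∃ f : Fin d → ℂ, (∀ i, ‖f i‖ = 1) ∧
      (U * Matrix.diagonal f + (U * Matrix.diagonal f)ᴴ -
        (2 * ν : ℂ) • (1 : Matrix (Fin d) (Fin d) ℂ)).PosSemidef := by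
  obtain ⟨e, he, h⟩ := exists_dual_vector hν hmin
  -- `g` holds the phases in the polar form `e = g |e|`; the moduli become the contraction `r`.
  choose g hg1 hg2 using fun i => exists_phase (starRingEnd ℂ (e i))
  have hge : ∀ i, g i * (‖e i‖ : ℂ) = e i := by
    intro i
    have h1 := hg2 i
    rw [RCLike.norm_conj] at h1
    have h2 := congrArg (starRingEnd ℂ) h1
    rw [map_mul, Complex.conj_conj, Complex.conj_ofReal] at h2
    have h3 : g i * starRingEnd ℂ (g i) = 1 := by rw [Complex.mul_conj', hg1 i]; simp
    rw [← h2]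
    linear_combination e i * h3
  obtain ⟨h1, h2⟩ := mul_diagonal_unitary hU hg1
  refine ⟨g, hg1, posSemidef_unitary_of_contraction h1 h2 he (fun i => norm_nonneg _) hν
    (posSemidef_of_forall_le_trace fun ρ hρ => (h ρ hρ).trans (le_of_eq ?_))⟩
  congr 1
  refine Finset.sum_congr rfl fun i _ => ?_
  rw [Matrix.diag_apply, mul_mul_diagonal_apply_self, mul_mul_diagonal_apply_self, mul_assoc, hge]

end DiagonalUnitaries

/-! ### A minimizer that commutes with the unitary -/

section Minimizers

variable {d : ℕ}

/-- A minimizer of the convex program can be averaged to one that commutes with `V`. -/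
theorem exists_invariant_minimizer {V : Matrix (Fin d) (Fin d) ℂ} (hV : Vᴴ * V = 1)
    (hV' : V * Vᴴ = 1) {ν : ℝ} (hν0 : 0 ≤ ν) (hν : ν < 1)
    (h : (V + Vᴴ - (2 * ν : ℂ) • (1 : Matrix (Fin d) (Fin d) ℂ)).PosSemidef)
    {τ : Matrix (Fin d) (Fin d) ℂ} (hτ : τ ∈ densityMatrices d) (hτν : ∑ i, ‖(τ * V) i i‖ = ν) :
    ∃ ρ ∈ densityMatrices d, (∀ i, (ρ * V) i i = ν * ρ i i) ∧ Vᴴ * ρ * V = ρ := by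
  obtain ⟨h1, h2⟩ := le_trace_re_of_posSemidef h hτ
  have htr : (τ * V).trace.re = ∑ i, ((τ * V) i i).re := by
    simp [Matrix.trace]
  have hle : ∑ i, ((τ * V) i i).re ≤ ∑ i, ‖(τ * V) i i‖ :=
    Finset.sum_le_sum fun i _ => Complex.re_le_norm _
  have heq : ∑ i, ((τ * V) i i).re = ∑ i, ‖(τ * V) i i‖ := by linarith
  have hre : ∀ i, ((τ * V) i i).re = ‖(τ * V) i i‖ := fun i =>
    (Finset.sum_eq_sum_iff_of_le fun i _ => Complex.re_le_norm _).1 heq i (Finset.mem_univ i)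
  have him : ∀ i, starRingEnd ℂ ((τ * V) i i) = (τ * V) i i := by
    intro i
    have := (Complex.re_eq_norm.1 (hre i))
    exact Complex.conj_eq_iff_im.2 (Complex.le_def.1 this).2.symm
  -- Complementary slackness: two positive semidefinite matrices whose product has trace zero have
  -- product zero.
  have hzero : (V + Vᴴ - (2 * ν : ℂ) • 1) * τ = 0 := by
    obtain ⟨B, hB⟩ := exists_eq_mul_conjTranspose_of_rank_le hτ.1 (Matrix.rank_le_height τ)
    obtain ⟨G, hG⟩ := exists_eq_mul_conjTranspose_of_rank_le h (Matrix.rank_le_height _)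
    have h3 : hsSq (Gᴴ * B) = 0 := by
      rw [hsSq, Matrix.conjTranspose_mul, Matrix.conjTranspose_conjTranspose, Matrix.mul_assoc,
        ← Matrix.mul_assoc G, ← hG, Matrix.trace_mul_comm, Matrix.mul_assoc, ← hB,
        Matrix.trace_mul_comm, ← h1]
      linarith
    rw [hB, hG, Matrix.mul_assoc G, ← Matrix.mul_assoc Gᴴ, hsSq_eq_zero h3]
    simp
  -- On the kernel of `V + Vᴴ - 2ν`, which contains the range of `τ`, `N` is skew-Hermitian with `N²
  -- = -(1 - ν²)`.
  set N : Matrix (Fin d) (Fin d) ℂ := V - (ν : ℂ) • 1 with hN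
  have hNH : Nᴴ = Vᴴ - (ν : ℂ) • 1 := by
    rw [hN, Matrix.conjTranspose_sub, Matrix.conjTranspose_smul, Matrix.conjTranspose_one]
    simp
  have e1 : N * τ = -(Nᴴ * τ) := by
    rw [hNH, hN, eq_neg_iff_add_eq_zero, ← hzero]
    simp only [Matrix.sub_mul, Matrix.add_mul, Matrix.smul_mul, Matrix.one_mul]
    module
  have e1' : τ * Nᴴ = -(τ * N) := by
    have := congrArg Matrix.conjTranspose e1
    rwa [Matrix.conjTranspose_mul, Matrix.conjTranspose_neg, Matrix.conjTranspose_mul, hτ.1.1.eq,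
      Matrix.conjTranspose_conjTranspose] at this
  have e2 : Nᴴ * (N * τ) = ((1 - ν ^ 2 : ℝ) : ℂ) • τ := by
    have h3 : Nᴴ * N = ((1 - ν ^ 2 : ℝ) : ℂ) • 1 - (ν : ℂ) • (V + Vᴴ - (2 * ν : ℂ) • 1) := by
      rw [hNH, hN]
      simp only [Matrix.sub_mul, Matrix.mul_sub, Matrix.smul_mul, Matrix.mul_smul, Matrix.one_mul,
        Matrix.mul_one, hV]
      push_cast
      module
    rw [← Matrix.mul_assoc, h3, Matrix.sub_mul, Matrix.smul_mul, Matrix.smul_mul, hzero,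
      Matrix.one_mul]
    simp
  have e2' : τ * Nᴴ * N = ((1 - ν ^ 2 : ℝ) : ℂ) • τ := by
    have := congrArg Matrix.conjTranspose e2
    simpa only [Matrix.conjTranspose_mul, Matrix.conjTranspose_smul, hτ.1.1.eq,
      Matrix.conjTranspose_conjTranspose, RCLike.star_def, Complex.conj_ofReal] using this
  have e3 : N * N * τ = -(((1 - ν ^ 2 : ℝ) : ℂ) • τ) := by
    have hcomm : N * Nᴴ = Nᴴ * N := by
      rw [hNH, hN]
      simp only [Matrix.sub_mul, Matrix.mul_sub, Matrix.smul_mul, Matrix.mul_smul, Matrix.one_mul,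
        Matrix.mul_one, hV, hV']
      module
    rw [Matrix.mul_assoc, e1, Matrix.mul_neg, ← Matrix.mul_assoc, hcomm, Matrix.mul_assoc, e2]
  have hs : 0 < 1 - ν ^ 2 := by nlinarith
  set s : ℝ := 1 - ν ^ 2 with hsdef
  have hsc : (s : ℂ) ≠ 0 := by exact_mod_cast hs.ne'
  have hinv : ((s⁻¹ : ℝ) : ℂ) * (s : ℂ) = 1 := by push_cast; exact inv_mul_cancel₀ hsc
  -- The average of `τ` over conjugation by `N/√s`, which on that kernel is unitary with square
  -- `-1`.
  set ρ : Matrix (Fin d) (Fin d) ℂ := (1 / 2 : ℝ) • (τ + (s⁻¹ : ℝ) • (N * τ * Nᴴ)) with hρ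
  have hρ' : ρ = (1 / 2 : ℂ) • (τ + ((s⁻¹ : ℝ) : ℂ) • (N * τ * Nᴴ)) := by
    rw [hρ]
    ext i j
    simp
    ring
  have e4 : ρ * N = (1 / 2 : ℂ) • (τ * N + N * τ) := by
    rw [hρ', Matrix.smul_mul, Matrix.add_mul, Matrix.smul_mul, Matrix.mul_assoc N, Matrix.mul_assoc N,
      e2', Matrix.mul_smul, smul_smul, hinv, one_smul]
  have e5 : N * ρ = ρ * N := by
    rw [e4, hρ', Matrix.mul_smul, Matrix.mul_add, Matrix.mul_smul, ← Matrix.mul_assoc N,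
      ← Matrix.mul_assoc N, e3, Matrix.neg_mul, Matrix.smul_mul, smul_neg, smul_smul, hinv, one_smul, e1', neg_neg,
      add_comm]
  have hVN : V = N + (ν : ℂ) • 1 := by rw [hN]; abel
  have e6 : V * ρ = ρ * V := by
    rw [hVN, Matrix.add_mul, Matrix.mul_add, e5]; simp
  refine ⟨ρ, ⟨?_, ?_⟩, fun i => ?_, ?_⟩
  · exact (hτ.1.add ((hτ.1.mul_mul_conjTranspose_same N).smul (inv_nonneg.2 hs.le))).smul
      (by norm_num)
  · rw [hρ', Matrix.trace_smul, Matrix.trace_add, Matrix.trace_smul, Matrix.trace_mul_comm (N * τ), e2,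
      Matrix.trace_smul, hτ.2, smul_eq_mul, smul_eq_mul, smul_eq_mul, mul_one, hinv]
    norm_num
  · rw [hVN, Matrix.mul_add, Matrix.mul_smul, Matrix.mul_one, Matrix.add_apply, e4,
      Matrix.smul_apply, Matrix.smul_apply, Matrix.add_apply, smul_eq_mul, smul_eq_mul]
    -- As `(τN)ᵢᵢ` is real by minimality, the diagonals of `τN` and `Nτ` cancel, so `ρN` has zero
    -- diagonal.
    have h3 : (N * τ) i i = -starRingEnd ℂ ((τ * N) i i) := by
      rw [e1, Matrix.neg_apply, starRingEnd_apply, ← Matrix.conjTranspose_apply,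
        Matrix.conjTranspose_mul, hτ.1.1.eq]
    have h4 : starRingEnd ℂ ((τ * N) i i) = (τ * N) i i := by
      have h5 : starRingEnd ℂ (τ i i) = τ i i := hτ.1.1.apply i i
      rw [hN, Matrix.mul_sub, Matrix.mul_smul, Matrix.mul_one, Matrix.sub_apply, map_sub, him,
        Matrix.smul_apply, smul_eq_mul, map_mul, Complex.conj_ofReal, h5]
    rw [h3, h4]
    ring
  · rw [Matrix.mul_assoc, ← e6, ← Matrix.mul_assoc, hV, Matrix.one_mul]

end Minimizers

/-! ### Lower bounds on the trace norm from Gram matrices -/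

section LowerBound

/-- The Gram relations yield an explicit multiple of `|P Pᴴ - R Rᴴ|`, namely the Hermitian `T`
below: `T²` is `1 - ν²` times the square of the difference, and `Tr T = 2(1 - ν²)`. -/
theorem traceNorm_sub_ge_of_gram {ι n : Type*} [Fintype ι] [DecidableEq ι] [Fintype n]
    {P R : Matrix ι n ℂ} {Q : Matrix n n ℂ} {ν : ℝ} (hν0 : 0 ≤ ν) (hν : ν < 1)
    (hPP : Pᴴ * P = Q) (hRR : Rᴴ * R = Q) (hPR : Pᴴ * R = (ν : ℂ) • Q)
    (hRP : Rᴴ * P = (ν : ℂ) • Q) (hQ : Q.trace = 1) :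
    2 * √(1 - ν ^ 2) ≤ traceNorm (P * Pᴴ - R * Rᴴ) := by
  have hs : 0 < 1 - ν ^ 2 := by nlinarith
  have a1 : ∀ Z : Matrix n ι ℂ, Pᴴ * (P * Z) = Q * Z := fun Z => by rw [← Matrix.mul_assoc, hPP]
  have a2 : ∀ Z : Matrix n ι ℂ, Rᴴ * (R * Z) = Q * Z := fun Z => by rw [← Matrix.mul_assoc, hRR]
  have a3 : ∀ Z : Matrix n ι ℂ, Pᴴ * (R * Z) = (ν : ℂ) • (Q * Z) := fun Z => by
    rw [← Matrix.mul_assoc, hPR, Matrix.smul_mul]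
  have a4 : ∀ Z : Matrix n ι ℂ, Rᴴ * (P * Z) = (ν : ℂ) • (Q * Z) := fun Z => by
    rw [← Matrix.mul_assoc, hRP, Matrix.smul_mul]
  set T : Matrix ι ι ℂ := P * Pᴴ + R * Rᴴ - (ν : ℂ) • (P * Rᴴ + R * Pᴴ) with hT
  have hTH : Tᴴ = T := by
    rw [hT]
    simp only [Matrix.conjTranspose_sub, Matrix.conjTranspose_add, Matrix.conjTranspose_smul,
      Matrix.conjTranspose_mul, Matrix.conjTranspose_conjTranspose, RCLike.star_def,
      Complex.conj_ofReal]
    rw [add_comm (R * Pᴴ)]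
  have hTT : T * T = ((1 - ν ^ 2 : ℝ) : ℂ) • ((P * Pᴴ - R * Rᴴ)ᴴ * (P * Pᴴ - R * Rᴴ)) := by
    rw [hT]
    simp only [Matrix.conjTranspose_sub, Matrix.conjTranspose_mul,
      Matrix.conjTranspose_conjTranspose, Matrix.sub_mul, Matrix.mul_sub, Matrix.add_mul,
      Matrix.mul_add, Matrix.smul_mul, Matrix.mul_smul, Matrix.mul_assoc, a1, a2, a3, a4]
    push_cast
    module
  have hSS : (((√(1 - ν ^ 2))⁻¹ : ℝ) • T)ᴴ * (((√(1 - ν ^ 2))⁻¹ : ℝ) • T) =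
      (P * Pᴴ - R * Rᴴ)ᴴ * (P * Pᴴ - R * Rᴴ) := by
    rw [Matrix.conjTranspose_smul, hTH, Matrix.smul_mul, Matrix.mul_smul, hTT, smul_smul, star_trivial,
      ← mul_inv, Real.mul_self_sqrt hs.le, Complex.coe_smul, smul_smul, inv_mul_cancel₀ hs.ne',
      one_smul]
  refine le_of_eq_of_le ?_ (trace_re_le_traceNorm hSS)
  have htT : T.trace = ((2 * (1 - ν ^ 2) : ℝ) : ℂ) := by
    rw [hT, Matrix.trace_sub, Matrix.trace_add, Matrix.trace_smul, Matrix.trace_add,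
      Matrix.trace_mul_comm P, Matrix.trace_mul_comm R, Matrix.trace_mul_comm P,
      Matrix.trace_mul_comm R, hPP, hRR, hPR, hRP, Matrix.trace_smul, hQ]
    simp only [smul_eq_mul]
    push_cast
    ring
  rw [Matrix.trace_smul, htT, Complex.real_smul, ← Complex.ofReal_mul, Complex.ofReal_re]
  have h1 := Real.mul_self_sqrt hs.le
  have h2 := (Real.sqrt_pos.2 hs).ne'
  field_simp
  linarith

/-- The case `ν = 0`, where `P Pᴴ + R Rᴴ` has the same square as the difference and no equality of
`Pᴴ P` and `Rᴴ R` is needed. -/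
theorem traceNorm_sub_ge_of_orthogonal {ι n : Type*} [Fintype ι] [DecidableEq ι] [Fintype n]
    {P R : Matrix ι n ℂ} (hPR : Pᴴ * R = 0) :
    hsSq P + hsSq R ≤ traceNorm (P * Pᴴ - R * Rᴴ) := by
  have hRP : Rᴴ * P = 0 := by
    have := congrArg Matrix.conjTranspose hPR
    simpa using this
  have a3 : ∀ Z : Matrix n ι ℂ, Pᴴ * (R * Z) = 0 := fun Z => by
    rw [← Matrix.mul_assoc, hPR, Matrix.zero_mul]
  have a4 : ∀ Z : Matrix n ι ℂ, Rᴴ * (P * Z) = 0 := fun Z => by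
    rw [← Matrix.mul_assoc, hRP, Matrix.zero_mul]
  have hS : (P * Pᴴ + R * Rᴴ)ᴴ * (P * Pᴴ + R * Rᴴ) =
      (P * Pᴴ - R * Rᴴ)ᴴ * (P * Pᴴ - R * Rᴴ) := by
    simp only [Matrix.conjTranspose_sub, Matrix.conjTranspose_add, Matrix.conjTranspose_mul,
      Matrix.conjTranspose_conjTranspose, Matrix.sub_mul, Matrix.mul_sub, Matrix.add_mul,
      Matrix.mul_add, Matrix.mul_assoc, a3, a4, Matrix.mul_zero]
    simp
  refine le_of_eq_of_le ?_ (trace_re_le_traceNorm hS)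
  rw [Matrix.trace_add, Complex.add_re, hsSq, hsSq, Matrix.trace_mul_comm, Matrix.trace_mul_comm R]

/-- For pure inputs the Gram matrices see only the diagonals of reduced operators; this turns
conditions on `ρ` into the Gram relations. -/
theorem conjTranspose_blockExpand_mul {d k : ℕ} (C D : Matrix (Fin d × Fin k) Unit ℂ) :
    (blockExpand C)ᴴ * blockExpand D =
      Matrix.diagonal fun q : Fin d × Unit => partialTrace (D * Cᴴ) q.1 q.1 := by
  ext ⟨i, u⟩ ⟨j, v⟩
  simp only [blockExpand, Matrix.mul_apply, Matrix.conjTranspose_apply, Matrix.of_apply,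
    Fintype.sum_prod_type, Matrix.diagonal_apply, partialTrace]
  rw [Finset.sum_eq_single i]
  · by_cases h : i = j
    · subst h
      simp [mul_comm]
    · simp [h]
  · intro b _ hb
    simp [hb]
  · simp

end LowerBound

/-! ### Purifications -/

section Purification

variable {d k : ℕ}

theorem pureState_eq_mul (ψ : Fin d × Fin k → ℂ) :
    pureState ψ = Matrix.replicateCol Unit ψ * (Matrix.replicateCol Unit ψ)ᴴ := by
  rw [pureState, Matrix.vecMulVec_eq Unit, Matrix.conjTranspose_replicateCol]

theorem isPurification_iff {ρ : Matrix (Fin d) (Fin d) ℂ} {ψ : Fin d × Fin k → ℂ} :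
    IsPurification ρ ψ ↔ partialTrace (pureState ψ) = ρ :=
  ⟨fun h => Matrix.ext h, fun h i j => congrFun (congrFun h i) j⟩

theorem trace_pureState (ψ : Fin d × Fin k → ℂ) : (pureState ψ).trace = star ψ ⬝ᵥ ψ := by
  rw [pureState, Matrix.trace_vecMulVec, dotProduct_comm]

theorem hsSq_replicateCol (ψ : Fin d × Fin k → ℂ) :
    (hsSq (Matrix.replicateCol Unit ψ) : ℂ) = star ψ ⬝ᵥ ψ := by
  rw [← trace_conjTranspose_mul_self, Matrix.trace_mul_comm, ← pureState_eq_mul, trace_pureState]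

theorem hsSq_replicateCol_eq_one {ψ : Fin d × Fin k → ℂ} (hψ : star ψ ⬝ᵥ ψ = 1) :
    hsSq (Matrix.replicateCol Unit ψ) = 1 := by
  exact_mod_cast (hsSq_replicateCol ψ).trans hψ

theorem partialTrace_mem_densityMatrices {r : Type*} [Fintype r] {C : Matrix (Fin d × Fin k) r ℂ}
    (hC : hsSq C = 1) : partialTrace (C * Cᴴ) ∈ densityMatrices d := by
  refine ⟨posSemidef_partialTrace C, ?_⟩
  rw [trace_partialTrace, Matrix.trace_mul_comm, trace_conjTranspose_mul_self, hC]
  simp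

theorem IsPurification.star_dotProduct_self {ρ : Matrix (Fin d) (Fin d) ℂ} {ψ : Fin d × Fin k → ℂ}
    (h : IsPurification ρ ψ) (hρ : ρ ∈ densityMatrices d) : star ψ ⬝ᵥ ψ = 1 := by
  rw [← trace_pureState, ← trace_partialTrace, isPurification_iff.1 h, hρ.2]

/-- Reading `ψ` as a `d × k` matrix `B`, its reduced state is `B Bᴴ`. -/
theorem exists_isPurification_iff {ρ : Matrix (Fin d) (Fin d) ℂ} (hρ : ρ.PosSemidef) (k : ℕ) :
    (∃ ψ : Fin d × Fin k → ℂ, IsPurification ρ ψ) ↔ ρ.rank ≤ k := by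
  have key : ∀ ψ : Fin d × Fin k → ℂ, partialTrace (pureState ψ) =
      (Matrix.of fun i a => ψ (i, a)) * (Matrix.of fun i a => ψ (i, a))ᴴ := by
    intro ψ
    ext i j
    simp [partialTrace, pureState, Matrix.vecMulVec_apply, Matrix.mul_apply]
  constructor
  · rintro ⟨ψ, hψ⟩
    rw [← isPurification_iff.1 hψ, key]
    exact (Matrix.rank_mul_le_left _ _).trans (Matrix.rank_le_width _)
  · intro h
    obtain ⟨B, rfl⟩ := exists_eq_mul_conjTranspose_of_rank_le hρ h
    exact ⟨fun p => B p.1 p.2, isPurification_iff.2 (key _)⟩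

theorem traceNorm_pureState {ψ : Fin d × Fin k → ℂ} (hψ : star ψ ⬝ᵥ ψ = 1) :
    traceNorm (pureState ψ) = 1 := by
  apply le_antisymm
  · rw [pureState_eq_mul]
    refine (traceNorm_mul_conjTranspose_le _ _).trans ?_
    rw [hsSq_replicateCol_eq_one hψ]
    simp
  · have h1 := trace_re_le_traceNorm (X := pureState ψ) (S := pureState ψ) rfl
    rw [trace_pureState, hψ] at h1
    exact h1

end Purification

/-! ### Optimal discrimination -/

section Discrimination

variable {d : ℕ} {U : Matrix (Fin d) (Fin d) ℂ}

theorem trace_conjTranspose_mul_re {ρ : Matrix (Fin d) (Fin d) ℂ} (hρ : ρ.IsHermitian)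
    (V : Matrix (Fin d) (Fin d) ℂ) : (Vᴴ * ρ).trace.re = (ρ * V).trace.re := by
  rw [← Complex.conj_re (ρ * V).trace, starRingEnd_apply, ← Matrix.trace_conjTranspose,
    Matrix.conjTranspose_mul, hρ.eq]

theorem exists_phases_trace_eq (ρ U : Matrix (Fin d) (Fin d) ℂ) :
    ∃ f : Fin d → ℂ, (∀ i, ‖f i‖ = 1) ∧
      (ρ * (U * Matrix.diagonal f)).trace.re = ∑ i, ‖(ρ * U) i i‖ := by
  choose f hf1 hf2 using fun i => exists_phase ((ρ * U) i i)
  refine ⟨f, hf1, ?_⟩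
  rw [Matrix.trace, Complex.re_sum]
  refine Finset.sum_congr rfl fun i _ => ?_
  rw [Matrix.diag_apply, mul_mul_diagonal_apply_self, hf2, Complex.ofReal_re]

theorem sum_norm_diag_le_one (hU : U ∈ Matrix.unitaryGroup (Fin d) ℂ) {k : ℕ} {r : Type*}
    [Fintype r] {C : Matrix (Fin d × Fin k) r ℂ} (hC : hsSq C = 1) :
    ∑ i, ‖(partialTrace (C * Cᴴ) * U) i i‖ ≤ 1 := by
  obtain ⟨f, hf, h⟩ := exists_phases_trace_eq (partialTrace (C * Cᴴ)) U
  rw [← h, ← trace_conjTranspose_mul_re (posSemidef_partialTrace C).1]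
  exact le_of_abs_le (abs_trace_mul_partialTrace_le (mul_diagonal_unitary hU hf).2 hC)

/-- The phases are adapted to this one state, so no duality is needed; this bound drives the
converse. -/
theorem traceNorm_ampliation_pureState_le (hU : U ∈ Matrix.unitaryGroup (Fin d) ℂ) {k : ℕ}
    {ψ : Fin d × Fin k → ℂ} (hψ : star ψ ⬝ᵥ ψ = 1) :
    traceNorm (ampliation (measurement U - measurement 1) k (pureState ψ)) ≤
      2 * √(1 - (∑ i, ‖(partialTrace (pureState ψ) * U) i i‖) ^ 2) := by
  obtain ⟨f, hf, h⟩ := exists_phases_trace_eq (partialTrace (pureState ψ)) U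
  rw [pureState_eq_mul] at h ⊢
  rw [← trace_conjTranspose_mul_re (posSemidef_partialTrace _).1] at h
  rw [← measurement_mul_diagonal U hf]
  exact traceNorm_ampliation_sub_le_of_le (mul_diagonal_unitary hU hf).2
    (hsSq_replicateCol_eq_one hψ) (hsSq_replicateCol_eq_one hψ)
    (Finset.sum_nonneg fun _ _ => norm_nonneg _) h.ge h.ge

theorem sqrt_mul_add_sqrt_mul_le_two {r t : ℝ} (hr : |r| ≤ 1) (ht : |t| ≤ 1) :
    √(1 - r) * √(1 + t) + √(1 + r) * √(1 - t) ≤ 2 := by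
  obtain ⟨h1, h2⟩ := abs_le.1 hr
  obtain ⟨h3, h4⟩ := abs_le.1 ht
  nlinarith [Real.sq_sqrt (by linarith : 0 ≤ 1 - r), Real.sq_sqrt (by linarith : 0 ≤ 1 + r),
    Real.sq_sqrt (by linarith : 0 ≤ 1 - t), Real.sq_sqrt (by linarith : 0 ≤ 1 + t),
    sq_nonneg (√(1 - r) - √(1 + t)), sq_nonneg (√(1 + r) - √(1 - t))]

theorem traceNorm_ampliation_le (hU : U ∈ Matrix.unitaryGroup (Fin d) ℂ) {ν : ℝ} (hν : 0 ≤ ν)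
    (hmin : ∀ ρ ∈ densityMatrices d, ν ≤ ∑ i, ‖(ρ * U) i i‖) {k : ℕ}
    {X : Matrix (Fin d × Fin k) (Fin d × Fin k) ℂ} (hX : traceNorm X = 1) :
    traceNorm (ampliation (measurement U - measurement 1) k X) ≤ 2 * √(1 - ν ^ 2) := by
  obtain ⟨C, D, rfl, hC, hD⟩ := exists_balanced_factorization X
  rw [hX] at hC hD
  rcases hν.eq_or_lt with rfl | hpos
  · have hU' : U * Uᴴ = 1 := Matrix.mem_unitaryGroup_iff.1 hU
    refine (traceNorm_ampliation_sub_le hU' hC hD).trans ?_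
    refine (sqrt_mul_add_sqrt_mul_le_two (abs_trace_mul_partialTrace_le hU' hC)
      (abs_trace_mul_partialTrace_le hU' hD)).trans ?_
    simp
  · obtain ⟨f, hf, hpsd⟩ := exists_dual_unitary hU hpos hmin
    have hbound : ∀ F : Matrix (Fin d × Fin k) (Fin d × Fin k) ℂ, hsSq F = 1 →
        ν ≤ ((U * Matrix.diagonal f)ᴴ * partialTrace (F * Fᴴ)).trace.re := by
      intro F hF
      rw [trace_conjTranspose_mul_re (posSemidef_partialTrace F).1]
      exact (le_trace_re_of_posSemidef hpsd (partialTrace_mem_densityMatrices hF)).2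
    rw [← measurement_mul_diagonal U hf]
    exact traceNorm_ampliation_sub_le_of_le (mul_diagonal_unitary hU hf).2 hC hD hν
      (hbound C hC) (hbound D hD)

theorem exists_optimal_densityMatrix (hU : U ∈ Matrix.unitaryGroup (Fin d) ℂ) {ν : ℝ}
    (hν : 0 ≤ ν) (hν1 : ν ≤ 1) (hmin : ∀ ρ ∈ densityMatrices d, ν ≤ ∑ i, ‖(ρ * U) i i‖)
    {τ : Matrix (Fin d) (Fin d) ℂ} (hτ : τ ∈ densityMatrices d) (hτν : ∑ i, ‖(τ * U) i i‖ = ν) :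
    ∃ ρ ∈ densityMatrices d, ∑ i, ‖(ρ * U) i i‖ = ν ∧ ∀ (k : ℕ) (ψ : Fin d × Fin k → ℂ),
      IsPurification ρ ψ → 2 * √(1 - ν ^ 2) ≤
        traceNorm (ampliation (measurement U - measurement 1) k (pureState ψ)) := by
  rcases hν1.eq_or_lt with rfl | hlt
  -- For `ν = 1` the claimed lower bound is 0.
  · refine ⟨τ, hτ, hτν, fun k ψ _ => ?_⟩
    simpa using traceNorm_nonneg _
  rcases hν.eq_or_lt with rfl | hpos
  -- For `ν = 0` the diagonal of `τU` vanishes, so the expanded factors are orthogonal and any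
  -- minimizer works.
  · refine ⟨τ, hτ, hτν, fun k ψ hψ => ?_⟩
    have hψ1 := hsSq_replicateCol_eq_one (hψ.star_dotProduct_self hτ)
    have hdiag : ∀ i, (τ * U) i i = 0 := fun i =>
      norm_eq_zero.1 ((Finset.sum_eq_zero_iff_of_nonneg fun _ _ => norm_nonneg _).1 hτν i
        (Finset.mem_univ i))
    rw [pureState_eq_mul, ampliation_sub_measurement_one]
    refine le_of_eq_of_le ?_ (traceNorm_sub_ge_of_orthogonal ?_)
    · rw [hsSq_blockExpand, hsSq_blockExpand, hsSq_tensorOne_mul (Matrix.mem_unitaryGroup_iff.1 hU),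
        hψ1]
      norm_num
    · rw [conjTranspose_blockExpand_mul, Matrix.conjTranspose_mul, conjTranspose_tensorOne,
        Matrix.conjTranspose_conjTranspose, ← Matrix.mul_assoc, partialTrace_mul_tensorOne,
        ← pureState_eq_mul, isPurification_iff.1 hψ]
      simp [hdiag]
  · obtain ⟨f, hf, hpsd⟩ := exists_dual_unitary hU hpos hmin
    obtain ⟨hV, hV'⟩ := mul_diagonal_unitary hU hf
    have hnorm : ∀ (ρ : Matrix (Fin d) (Fin d) ℂ) i,
        ‖(ρ * (U * Matrix.diagonal f)) i i‖ = ‖(ρ * U) i i‖ := by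
      intro ρ i
      rw [mul_mul_diagonal_apply_self, norm_mul, hf, mul_one]
    set V := U * Matrix.diagonal f with hVdef
    clear_value V
    obtain ⟨ρ, hρ, hρV, hρinv⟩ := exists_invariant_minimizer hV hV' hν hlt hpsd hτ
      ((Finset.sum_congr rfl fun i _ => hnorm τ i).trans hτν)
    refine ⟨ρ, hρ, ?_, fun k ψ hψ => ?_⟩
    · have h1 : ∀ i, ‖(ρ * U) i i‖ = ν * (ρ i i).re := by
        intro i
        have h2 := Complex.re_eq_norm.2 (hρ.1.diag_nonneg (i := i))
        rw [← hnorm, hρV, norm_mul, Complex.norm_real, Real.norm_of_nonneg hν, h2]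
      have h3 : ∑ i, (ρ i i).re = 1 := by
        have := congrArg Complex.re hρ.2
        simpa [Matrix.trace] using this
      rw [Finset.sum_congr rfl fun i _ => h1 i, ← Finset.mul_sum, h3, mul_one]
    · have hVρ : ∀ i, (Vᴴ * ρ) i i = ν * ρ i i := by
        intro i
        have h1 : (Vᴴ * ρ) i i = starRingEnd ℂ ((ρ * V) i i) := by
          rw [starRingEnd_apply, ← Matrix.conjTranspose_apply, Matrix.conjTranspose_mul,
            hρ.1.1.eq]
        have h2 : starRingEnd ℂ (ρ i i) = ρ i i := hρ.1.1.apply i i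
        rw [h1, hρV, map_mul, Complex.conj_ofReal, h2]
      have hp : partialTrace (Matrix.replicateCol Unit ψ * (Matrix.replicateCol Unit ψ)ᴴ) = ρ := by
        rw [← pureState_eq_mul, isPurification_iff.1 hψ]
      rw [pureState_eq_mul, ← measurement_mul_diagonal U hf, ampliation_sub_measurement_one,
        ← hVdef]
      refine traceNorm_sub_ge_of_gram (Q := Matrix.diagonal fun q : Fin d × Unit => ρ q.1 q.1)
        hν hlt ?_ ?_ ?_ ?_ ?_
      · rw [conjTranspose_blockExpand_mul, Matrix.conjTranspose_mul, conjTranspose_tensorOne,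
          Matrix.conjTranspose_conjTranspose, ← Matrix.mul_assoc, partialTrace_mul_tensorOne,
          Matrix.mul_assoc, partialTrace_tensorOne_mul, hp, hρinv]
      · rw [conjTranspose_blockExpand_mul, hp]
      · rw [conjTranspose_blockExpand_mul, Matrix.conjTranspose_mul, conjTranspose_tensorOne,
          Matrix.conjTranspose_conjTranspose, ← Matrix.mul_assoc, partialTrace_mul_tensorOne, hp,
          ← Matrix.diagonal_smul]
        congr 1
        funext q
        exact hρV q.1
      · rw [conjTranspose_blockExpand_mul, Matrix.mul_assoc, partialTrace_tensorOne_mul, hp,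
          ← Matrix.diagonal_smul]
        congr 1
        funext q
        exact hVρ q.1
      · rw [Matrix.trace_diagonal, Fintype.sum_prod_type]
        simpa [Matrix.trace] using hρ.2

theorem norm_trace_mul_le (ρ U : Matrix (Fin d) (Fin d) ℂ) {E : Matrix (Fin d) (Fin d) ℂ}
    (hE : E ∈ diagUnitaries d) : ‖(ρ * U * E).trace‖ ≤ ∑ i, ‖(ρ * U) i i‖ := by
  obtain ⟨f, hf, rfl⟩ := exists_eq_diagonal_of_mem_diagUnitaries hE
  refine (norm_sum_le _ _).trans (Finset.sum_le_sum fun i _ => ?_)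
  rw [Matrix.diag_apply, Matrix.mul_diagonal, norm_mul, hf, mul_one]

end Discrimination

end DiamondMeas

/-! ### The main theorem -/

theorem mainTheorem2 (d : ℕ) (hd : 0 < d) (U : Matrix (Fin d) (Fin d) ℂ)
    (hU : U ∈ Matrix.unitaryGroup (Fin d) ℂ) :
    ∃ ν : ℝ,
      -- `ν` is the minimum of the convex program
      IsLeast ((fun ρ => DiamondMeas.l1Norm (Uᴴ * ρ).diag) '' DiamondMeas.densityMatrices d) ν ∧
      -- `ν = min_ρ ∑ᵢ |⟨i|ρU|i⟩|`
      IsLeast ((fun ρ : Matrix (Fin d) (Fin d) ℂ => ∑ i, ‖(ρ * U) i i‖) ''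
        DiamondMeas.densityMatrices d) ν ∧
      -- `ν = max_E min_ρ |Tr ρUE|`, where all the minima and the maximum exist
      (∀ E ∈ DiamondMeas.diagUnitaries d, ∃ r : ℝ,
        IsLeast ((fun ρ => ‖(ρ * U * E).trace‖) '' DiamondMeas.densityMatrices d) r) ∧
      IsGreatest {r : ℝ | ∃ E ∈ DiamondMeas.diagUnitaries d,
        IsLeast ((fun ρ => ‖(ρ * U * E).trace‖) '' DiamondMeas.densityMatrices d) r} ν ∧
      -- the diamond norm, whose defining maximum is attained, is `2√(1 - ν²)`
      IsGreatest (DiamondMeas.diamondValues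
        (DiamondMeas.measurement U - DiamondMeas.measurement 1))
        (DiamondMeas.diamondNorm (DiamondMeas.measurement U - DiamondMeas.measurement 1)) ∧
      DiamondMeas.diamondNorm (DiamondMeas.measurement U - DiamondMeas.measurement 1)
        = 2 * √(1 - ν ^ 2) ∧
      -- some minimizer has purifications exactly with ancillas of dimension at least its rank,
      -- and all of its purifications are optimal input states
      (∃ ρ ∈ DiamondMeas.densityMatrices d, DiamondMeas.l1Norm (Uᴴ * ρ).diag = ν ∧
        ∀ k : ℕ,
          ((∃ ψ : Fin d × Fin k → ℂ, DiamondMeas.IsPurification ρ ψ) ↔ ρ.rank ≤ k) ∧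
          ∀ ψ : Fin d × Fin k → ℂ, DiamondMeas.IsPurification ρ ψ →
            DiamondMeas.IsOptimalInput
              (DiamondMeas.measurement U) (DiamondMeas.measurement 1) ψ) ∧
      -- every optimal input state is a purification of a minimizer
      (∀ (k : ℕ) (ψ : Fin d × Fin k → ℂ),
        DiamondMeas.IsOptimalInput (DiamondMeas.measurement U) (DiamondMeas.measurement 1) ψ →
        ∃ ρ ∈ DiamondMeas.densityMatrices d,
          DiamondMeas.IsPurification ρ ψ ∧ DiamondMeas.l1Norm (Uᴴ * ρ).diag = ν) := by
  obtain ⟨τ, hτ, hleast⟩ := DiamondMeas.exists_isLeast_densityMatrices hd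
    (f := fun ρ : Matrix (Fin d) (Fin d) ℂ => ∑ i, ‖(ρ * U) i i‖) (by fun_prop)
  set ν : ℝ := ∑ i, ‖(τ * U) i i‖ with hν
  have hν0 : 0 ≤ ν := Finset.sum_nonneg fun _ _ => norm_nonneg _
  have hmin : ∀ ρ ∈ DiamondMeas.densityMatrices d, ν ≤ ∑ i, ‖(ρ * U) i i‖ :=
    fun ρ hρ => hleast.2 ⟨ρ, hρ, rfl⟩
  obtain ⟨φ, hφ⟩ := (DiamondMeas.exists_isPurification_iff hτ.1 d).2 (Matrix.rank_le_height τ)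
  have hν1 : ν ≤ 1 := by
    have h1 := DiamondMeas.sum_norm_diag_le_one hU
      (DiamondMeas.hsSq_replicateCol_eq_one (hφ.star_dotProduct_self hτ))
    rwa [← DiamondMeas.pureState_eq_mul, DiamondMeas.isPurification_iff.1 hφ] at h1
  obtain ⟨ρ, hρ, hρν, hopt⟩ :=
    DiamondMeas.exists_optimal_densityMatrix hU hν0 hν1 hmin hτ hν.symm
  have hsame : ∀ σ ∈ DiamondMeas.densityMatrices d,
      DiamondMeas.l1Norm (Uᴴ * σ).diag = ∑ i, ‖(σ * U) i i‖ :=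
    fun σ hσ => DiamondMeas.l1Norm_diag_conjTranspose_mul hσ.1.1 U
  have hE : ∀ E ∈ DiamondMeas.diagUnitaries d, ∃ r : ℝ,
      IsLeast ((fun ρ => ‖(ρ * U * E).trace‖) '' DiamondMeas.densityMatrices d) r := by
    intro E _
    obtain ⟨σ, _, h⟩ := DiamondMeas.exists_isLeast_densityMatrices hd
      (f := fun ρ : Matrix (Fin d) (Fin d) ℂ => ‖(ρ * U * E).trace‖) (by fun_prop)
    exact ⟨_, h⟩
  have hle : ∀ {r : ℝ}, ∀ E ∈ DiamondMeas.diagUnitaries d,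
      IsLeast ((fun ρ => ‖(ρ * U * E).trace‖) '' DiamondMeas.densityMatrices d) r → r ≤ ν :=
    fun E hE h => (h.2 ⟨τ, hτ, rfl⟩).trans (DiamondMeas.norm_trace_mul_le τ U hE)
  have hdual : ∃ E ∈ DiamondMeas.diagUnitaries d,
      IsLeast ((fun ρ => ‖(ρ * U * E).trace‖) '' DiamondMeas.densityMatrices d) ν := by
    -- The separation argument needs `ν > 0`; for `ν = 0`, `E = 1` works because its minimum lies
    -- between 0 and `ν`.
    rcases hν0.eq_or_lt with h0 | hpos
    · have h1 : (1 : Matrix (Fin d) (Fin d) ℂ) ∈ DiamondMeas.diagUnitaries d :=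
        ⟨one_mem _, Matrix.isDiag_one⟩
      obtain ⟨r, hr⟩ := hE 1 h1
      have h2 := hle 1 h1 hr
      obtain ⟨σ, _, hσ⟩ := hr.1
      have h3 : 0 ≤ r := hσ ▸ norm_nonneg _
      have h4 : r = ν := by linarith
      exact ⟨1, h1, h4 ▸ hr⟩
    · obtain ⟨f, hf, hpsd⟩ := DiamondMeas.exists_dual_unitary hU hpos hmin
      have h1 := DiamondMeas.diagonal_mem_diagUnitaries hf
      have h2 : ∀ σ ∈ DiamondMeas.densityMatrices d, ν ≤ ‖(σ * U * Matrix.diagonal f).trace‖ := by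
        intro σ hσ
        rw [Matrix.mul_assoc]
        exact (DiamondMeas.le_trace_re_of_posSemidef hpsd hσ).2.trans (Complex.re_le_norm _)
      refine ⟨_, h1, ⟨τ, hτ, ?_⟩, ?_⟩
      · exact le_antisymm (DiamondMeas.norm_trace_mul_le τ U h1) (h2 τ hτ)
      · rintro _ ⟨σ, hσ, rfl⟩
        exact h2 σ hσ
  have hupper : ∀ {k : ℕ} {X : Matrix (Fin d × Fin k) (Fin d × Fin k) ℂ},
      DiamondMeas.traceNorm X = 1 → DiamondMeas.traceNorm (DiamondMeas.ampliation
        (DiamondMeas.measurement U - DiamondMeas.measurement 1) k X) ≤ 2 * √(1 - ν ^ 2) :=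
    fun hX => DiamondMeas.traceNorm_ampliation_le hU hν0 hmin hX
  have hval : ∀ {k : ℕ} (ψ : Fin d × Fin k → ℂ), DiamondMeas.IsPurification ρ ψ →
      DiamondMeas.traceNorm (DiamondMeas.ampliation
        (DiamondMeas.measurement U - DiamondMeas.measurement 1) k (DiamondMeas.pureState ψ)) =
        2 * √(1 - ν ^ 2) := fun ψ hψ =>
    le_antisymm (hupper (DiamondMeas.traceNorm_pureState (hψ.star_dotProduct_self hρ)))
      (hopt _ ψ hψ)
  have hgreat : IsGreatest (DiamondMeas.diamondValues
      (DiamondMeas.measurement U - DiamondMeas.measurement 1)) (2 * √(1 - ν ^ 2)) := by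
    constructor
    · obtain ⟨ψ, hψ⟩ := (DiamondMeas.exists_isPurification_iff hρ.1 d).2 (Matrix.rank_le_height ρ)
      exact ⟨_, DiamondMeas.traceNorm_pureState (hψ.star_dotProduct_self hρ), hval ψ hψ⟩
    · rintro _ ⟨X, hX, rfl⟩
      exact hupper hX
  have hnorm : DiamondMeas.diamondNorm (DiamondMeas.measurement U - DiamondMeas.measurement 1)
      = 2 * √(1 - ν ^ 2) := hgreat.csSup_eq
  refine ⟨ν, ?_, hleast, hE, ⟨hdual, ?_⟩, hnorm ▸ hgreat, hnorm,
    ⟨ρ, hρ, (hsame ρ hρ).trans hρν, fun k => ⟨DiamondMeas.exists_isPurification_iff hρ.1 k,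
      fun ψ hψ => ⟨hψ.star_dotProduct_self hρ, (hval ψ hψ).trans hnorm.symm⟩⟩⟩, ?_⟩
  · rw [Set.image_congr hsame]
    exact hleast
  · rintro r ⟨E, hE, h⟩
    exact hle E hE h
  · rintro k ψ ⟨hψ1, hψ2⟩
    have hmem : DiamondMeas.partialTrace (DiamondMeas.pureState ψ) ∈
        DiamondMeas.densityMatrices d := by
      rw [DiamondMeas.pureState_eq_mul]
      exact DiamondMeas.partialTrace_mem_densityMatrices (DiamondMeas.hsSq_replicateCol_eq_one hψ1)
    refine ⟨_, hmem, DiamondMeas.isPurification_iff.2 rfl, ?_⟩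
    rw [hsame _ hmem]
    -- Optimality gives `√(1 - ν²) ≤ √(1 - μ²)`, and `μ ≤ 1` allows the roots to be removed.
    refine le_antisymm ?_ (hmin _ hmem)
    have h1 := DiamondMeas.traceNorm_ampliation_pureState_le hU hψ1
    have h2 := DiamondMeas.sum_norm_diag_le_one hU (DiamondMeas.hsSq_replicateCol_eq_one hψ1)
    rw [← DiamondMeas.pureState_eq_mul] at h2
    rw [hψ2, hnorm] at h1
    set μ := ∑ i, ‖(DiamondMeas.partialTrace (DiamondMeas.pureState ψ) * U) i i‖ with hμ
    have hμ0 : 0 ≤ μ := Finset.sum_nonneg fun _ _ => norm_nonneg _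
    clear_value μ ν
    have hμ2 : 0 ≤ 1 - μ ^ 2 := sub_nonneg.2 (pow_le_one₀ hμ0 h2)
    have h3 : 1 - ν ^ 2 ≤ 1 - μ ^ 2 := (Real.sqrt_le_sqrt_iff hμ2).1 (by linarith)
    exact (sq_le_sq₀ hμ0 hν0).1 (by linarith)
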